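/- Let $\Phi=\{(X_i,M_i)\}_i$ be a simple, stationary marked point process in $\mathbb R^d$ with marks in a locally compact, second countable Hausdorff space $\mathbb M$, with finite positive intensity $\lambda=\mathbb E[\Phi([0,1]^d\times\mathbb M)]$. Let $S_x$ be the shift $(y,m)\mapsto(y-x,m)$ of configurations, $\mathbf N^0$ the set of configurations with a point at the origin, and $\mathbb P^0$ the Palm probability of $\Phi$ on $\mathbf N^0$, $\mathbb P^0(A)=\lambda^{-1}\,\mathbb E\big[\sum_{X_i\in[0,1]^d}\mathbf 1(S_{X_i}\Phi\in A)\big]$. A stationary $[0,\infty)$-marking of $\Phi$ is a stationary process $\Psi=\{(X_i,M_i,M_i')\}_i$ with $M'_i\in[0,\infty)$ whose projection $\{(X_i,M_i)\}_i$ has the law of $\Phi$; as usual, this projection is again written $\Phi$. Let $H:\mathbb R^d\times[0,\infty)\times\mathbf N^0\to[-\infty,\infty)$ be measurable, with all its values in $[0,\infty)\cup\{-\infty\}$ or all its values in $[-\infty,0]$, and consider the additive score $$\xi(\Psi)=\sum_i H(X_i,M_i',S_{X_i}\Phi)$$ (of a marking with a point at the origin), and the function $$f(m',\varphi)=\sum_{x\in\varphi}H(-x,m',\varphi),\qquad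 m'\ge 0,\ \varphi\in\mathbf N^0,$$ where a sum is $-\infty$ if one of its terms is. Let $\gamma_\xi(\Psi)=\mathbb E\big[\sum_{X_i\in[0,1]^d}\xi(S_{X_i}\Psi)\big]$ (an expectation of the form $\infty-\infty$ being read as $-\infty$), and $\gamma_{\xi,\mathrm{opt}}=\sup_\Psi\gamma_\xi(\Psi)$ over all stationary $[0,\infty)$-markings of $\Phi$. A stationary marking $\Psi$ is intensity-optimal if $\gamma_\xi(\Psi)=\gamma_{\xi,\mathrm{opt}}$. Assume that $m'\mapsto f(m',\varphi)$ is continuous (with values in $[-\infty,\infty]$) for $\mathbb P^0$-almost all $\varphi$, and that $-\infty<\gamma_{\xi,\mathrm{opt}}<\infty$. Let $M_i'=\arg\max_{m'\ge0}f(m',S_{X_i}\Phi)$, read as the smallest maximizer if there are several (and as $0$ if there is none). Then the marking $\{(X_i,M_i,M'_i)\}_i$ is the distributionally unique intensity-optimal marking (that is, it is intensity-optimal and every intensity-optimal marking has the same law) if and only if $f(\cdot,\Phi)$ has exactly one maximizer in $[0,\infty)$ $\mathbb P^0$-almost surely. -/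

import Mathlib

open MeasureTheory ProbabilityTheory
open scoped NNReal ENNReal

/-- Sum of an arbitrary family of extended reals: the sum of the positive parts minus the sum of
the negative parts. In `EReal` one has `⊤ - ⊤ = ⊥`, so for a family with values in
`[0, ∞] ∪ {-∞}` the sum is `-∞` as soon as one term is `-∞`. -/
noncomputable def esum {ι : Type*} (a : ι → EReal) : EReal :=
  ((∑' i, (a i).toENNReal : ℝ≥0∞) : EReal) - ((∑' i, (-a i).toENNReal : ℝ≥0∞) : EReal)

/-- Expectation of an extended real random variable: the integral of the positive part minus the
integral of the negative part (again `⊤ - ⊤ = ⊥`). -/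
noncomputable def eexpect {Ω : Type*} [MeasurableSpace Ω] (μ : Measure Ω) (X : Ω → EReal) :
    EReal :=
  ((∫⁻ ω, (X ω).toENNReal ∂μ : ℝ≥0∞) : EReal) - ((∫⁻ ω, (-X ω).toENNReal ∂μ : ℝ≥0∞) : EReal)

/-- The closed unit cube `[0, 1]^d`. -/
def unitCube (d : ℕ) : Set (EuclideanSpace ℝ (Fin d)) := {x | ∀ i, x i ∈ Set.Icc (0 : ℝ) 1}

/-- Simple locally finite marked configurations in `ℝ^d` with marks in `M`. -/
@[ext]
structure MarkedConfig (d : ℕ) (M : Type*) where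
  /-- The atoms `(x, m)`: location and mark. -/
  atoms : Set (EuclideanSpace ℝ (Fin d) × M)
  locallyFinite : ∀ B : Set (EuclideanSpace ℝ (Fin d)), Bornology.IsBounded B →
    {p ∈ atoms | p.1 ∈ B}.Finite
  simple : ∀ p ∈ atoms, ∀ q ∈ atoms, p.1 = q.1 → p = q

namespace MarkedConfig

variable {d : ℕ} {M : Type*}

/-- The evaluation `σ`-algebra, generated by the counts `φ ↦ #(φ ∩ B)` for measurable `B`. -/
noncomputable instance [MeasurableSpace M] : MeasurableSpace (MarkedConfig d M) :=
  ⨆ B : {B : Set (EuclideanSpace ℝ (Fin d) × M) // MeasurableSet B},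
    MeasurableSpace.comap (fun φ : MarkedConfig d M => (φ.atoms ∩ B.1).encard) ⊤

/-- The shift `S_y`, moving every atom `(x, m)` to `(x - y, m)`. -/
def shift (y : EuclideanSpace ℝ (Fin d)) (φ : MarkedConfig d M) : MarkedConfig d M where
  atoms := (fun p => (p.1 - y, p.2)) '' φ.atoms
  locallyFinite B hB := by
    have hB' : Bornology.IsBounded ((fun x => x + y) '' B) := by
      have h := hB.add (Bornology.isBounded_singleton (x := y))
      rwa [Set.add_singleton] at h
    refine ((φ.locallyFinite _ hB').image (fun p => (p.1 - y, p.2))).subset ?_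
    rintro _ ⟨⟨p, hp, rfl⟩, hpB⟩
    exact ⟨p, ⟨hp, p.1 - y, hpB, by simp⟩, rfl⟩
  simple := by
    rintro _ ⟨p, hp, rfl⟩ _ ⟨q, hq, rfl⟩ h
    have h' : p.1 = q.1 := by simpa using h
    rw [φ.simple p hp q hq h']

/-- The canonical projection `π`, forgetting the second mark. -/
def proj {M' : Type*} (ψ : MarkedConfig d (M × M')) : MarkedConfig d M where
  atoms := (fun q => (q.1, q.2.1)) '' ψ.atoms
  locallyFinite B hB := by
    refine ((ψ.locallyFinite B hB).image (fun q => (q.1, q.2.1))).subset ?_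
    rintro _ ⟨⟨q, hq, rfl⟩, hqB⟩
    exact ⟨q, ⟨hq, hqB⟩, rfl⟩
  simple := by
    rintro _ ⟨p, hp, rfl⟩ _ ⟨q, hq, rfl⟩ h
    rw [ψ.simple p hp q hq h]

end MarkedConfig

/-- The configurations with an atom at the origin (by simplicity it is the only one there). -/
abbrev PalmConfig (d : ℕ) (M : Type*) := {φ : MarkedConfig d M // ∃ m, (0, m) ∈ φ.atoms}

namespace MarkedConfig

variable {d : ℕ} {M : Type*}

/-- `S_x φ`, as a configuration with an atom at the origin, for an atom `p = (x, m)` of `φ`. -/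
def recenter (φ : MarkedConfig d M) (p : φ.atoms) : PalmConfig d M :=
  ⟨φ.shift p.1.1, p.1.2, p.1, p.2, by simp⟩

/-- The atoms of `φ` located in the unit cube. -/
def cubeAtoms (φ : MarkedConfig d M) : Set φ.atoms := {p | p.1.1 ∈ unitCube d}

/-- The marking of `φ` in which the atom `(x, m)` receives the new mark `g (S_x φ)`. -/
def markBy {M' : Type*} (g : PalmConfig d M → M') (φ : MarkedConfig d M) :
    MarkedConfig d (M × M') where
  atoms := Set.range fun p : φ.atoms => (p.1.1, p.1.2, g (φ.recenter p))
  locallyFinite B hB := by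
    have hfin : {p : φ.atoms | p.1.1 ∈ B}.Finite := by
      refine Set.Finite.of_finite_image (f := Subtype.val)
        ((φ.locallyFinite B hB).subset ?_) Subtype.val_injective.injOn
      rintro _ ⟨p, hp, rfl⟩
      exact ⟨p.2, hp⟩
    refine (hfin.image fun p : φ.atoms => (p.1.1, p.1.2, g (φ.recenter p))).subset ?_
    rintro _ ⟨⟨p, rfl⟩, hpB⟩
    exact ⟨p, hpB, rfl⟩
  simple := by
    rintro _ ⟨p, rfl⟩ _ ⟨q, rfl⟩ h
    rw [Subtype.ext (φ.simple p.1 p.2 q.1 q.2 h)]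

end MarkedConfig

section Measurability

namespace MarkedConfig

variable {d : ℕ} {M : Type*} [MeasurableSpace M]

/-- The counting measure of a configuration. -/
noncomputable def countingMeasure (φ : MarkedConfig d M) :
    Measure (EuclideanSpace ℝ (Fin d) × M) :=
  Measure.sum fun p : φ.atoms => Measure.dirac p.1

lemma countingMeasure_apply (φ : MarkedConfig d M)
    {B : Set (EuclideanSpace ℝ (Fin d) × M)} (hB : MeasurableSet B) :
    φ.countingMeasure B = ((φ.atoms ∩ B).encard : ℝ≥0∞) := by
  rw [countingMeasure, Measure.sum_apply _ hB]
  simp_rw [Measure.dirac_apply' _ hB]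
  rw [tsum_subtype φ.atoms (B.indicator (1 : EuclideanSpace ℝ (Fin d) × M → ℝ≥0∞)),
    Set.indicator_indicator,
    ← tsum_subtype (φ.atoms ∩ B) (1 : EuclideanSpace ℝ (Fin d) × M → ℝ≥0∞)]
  exact ENNReal.tsum_set_one (φ.atoms ∩ B)

lemma lintegral_countingMeasure (φ : MarkedConfig d M)
    {g : EuclideanSpace ℝ (Fin d) × M → ℝ≥0∞} (hg : Measurable g) :
    ∫⁻ p, g p ∂φ.countingMeasure = ∑' p : φ.atoms, g p.1 := by
  rw [countingMeasure, lintegral_sum_measure]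
  simp_rw [lintegral_dirac' _ hg]

lemma measurable_countingMeasure :
    Measurable (countingMeasure : MarkedConfig d M → _) := by
  refine Measure.measurable_of_measurable_coe _ fun B hB => ?_
  simp_rw [countingMeasure_apply _ hB]
  refine (measurable_from_top (f := fun n : ℕ∞ => (n : ℝ≥0∞))).comp
    (Measurable.of_comap_le ?_)
  exact le_iSup (fun B : {B : Set (EuclideanSpace ℝ (Fin d) × M) // MeasurableSet B} =>
    MeasurableSpace.comap (fun φ : MarkedConfig d M => (φ.atoms ∩ B.1).encard) ⊤) ⟨B, hB⟩

lemma measurable_of_count {α : Type*} [MeasurableSpace α] {g : α → MarkedConfig d M}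
    (h : ∀ B, MeasurableSet B → Measurable fun a => (g a).countingMeasure B) :
    Measurable g := by
  refine Measurable.of_le_map (iSup_le fun B => ?_)
  rw [MeasurableSpace.comap_le_iff_le_map, MeasurableSpace.map_comp]
  intro S _
  have hS : MeasurableSet ((fun n : ℕ∞ => (n : ℝ≥0∞)) '' S) :=
    ((Set.to_countable S).image _).measurableSet
  have h1 := h B.1 B.2 hS
  simp_rw [countingMeasure_apply _ B.2] at h1
  have h2 : (fun a => (((g a).atoms ∩ B.1).encard : ℝ≥0∞)) ⁻¹' ((fun n : ℕ∞ => (n : ℝ≥0∞)) '' S)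
      = (fun a => ((g a).atoms ∩ B.1).encard) ⁻¹' S := by
    ext a
    simp
  rw [h2] at h1
  exact h1

/-- The counting measure as a kernel. -/
noncomputable def countingKernel (d : ℕ) (M : Type*) [MeasurableSpace M] :
    Kernel (MarkedConfig d M) (EuclideanSpace ℝ (Fin d) × M) :=
  ⟨countingMeasure, measurable_countingMeasure⟩

/-- A spherical shell in `ℝ^d`, times the mark space. -/
def shell (d : ℕ) (M : Type*) (n : ℕ) : Set (EuclideanSpace ℝ (Fin d) × M) :=
  {p | ⌊‖p.1‖⌋₊ = n}

lemma measurableSet_shell (n : ℕ) : MeasurableSet (shell d M n) :=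
  (Nat.measurable_floor.comp measurable_fst.norm) (measurableSet_singleton n)

lemma shell_count (φ : MarkedConfig d M) (n : ℕ) :
    ∃ k : ℕ, φ.countingMeasure (shell d M n) = k := by
  have hfin : (φ.atoms ∩ shell d M n).Finite := by
    refine (φ.locallyFinite (Metric.closedBall 0 (n + 1)) Metric.isBounded_closedBall).subset ?_
    rintro p ⟨hp, hn⟩
    refine ⟨hp, ?_⟩
    have h := Nat.lt_floor_add_one ‖p.1‖
    have hn' : ⌊‖p.1‖⌋₊ = n := hn
    rw [hn'] at h
    simpa using h.le
  refine ⟨hfin.toFinset.card, ?_⟩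
  rw [countingMeasure_apply _ (measurableSet_shell n), hfin.encard_eq_coe_toFinset_card]
  simp

lemma measurableSet_shell_count (i : ℕ × ℕ) : MeasurableSet
    {φ : MarkedConfig d M | φ.countingMeasure (shell d M i.1) = (i.2 : ℝ≥0∞)} :=
  (Kernel.measurable_coe (countingKernel d M) (measurableSet_shell i.1))
    (measurableSet_singleton (i.2 : ℝ≥0∞))

open Classical in
/-- The part of the counting kernel on a shell, on the event that the shell has `k` atoms. -/
noncomputable def shellKernel (d : ℕ) (M : Type*) [MeasurableSpace M] (i : ℕ × ℕ) :
    Kernel (MarkedConfig d M) (EuclideanSpace ℝ (Fin d) × M) :=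
  Kernel.piecewise (measurableSet_shell_count i)
    ((countingKernel d M).restrict (measurableSet_shell i.1)) 0

lemma shellKernel_apply (i : ℕ × ℕ) (φ : MarkedConfig d M) :
    (φ.countingMeasure (shell d M i.1) = (i.2 : ℝ≥0∞) ∧
      shellKernel d M i φ = φ.countingMeasure.restrict (shell d M i.1)) ∨
    (φ.countingMeasure (shell d M i.1) ≠ (i.2 : ℝ≥0∞) ∧ shellKernel d M i φ = 0) := by
  classical
  by_cases h : φ.countingMeasure (shell d M i.1) = (i.2 : ℝ≥0∞)
  · refine Or.inl ⟨h, ?_⟩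
    rw [shellKernel, Kernel.piecewise_apply, if_pos (by exact h), Kernel.restrict_apply]
    rfl
  · refine Or.inr ⟨h, ?_⟩
    rw [shellKernel, Kernel.piecewise_apply, if_neg (by exact h)]
    rfl

instance : IsSFiniteKernel (countingKernel d M) := by
  have hf : ∀ i, IsFiniteKernel (shellKernel d M i) := fun i =>
    ⟨(i.2 : ℝ≥0∞), ENNReal.natCast_lt_top _, fun φ => by
      rcases shellKernel_apply i φ with ⟨h, h'⟩ | ⟨h, h'⟩
      · rw [h', Measure.restrict_apply_univ, h]
      · simp [h']⟩
  have hsum : countingKernel d M = Kernel.sum (shellKernel d M) := by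
    ext φ B hB
    rw [Kernel.sum_apply' _ _ hB, ENNReal.tsum_prod']
    have h1 : ∀ n, ∑' k, shellKernel d M (n, k) φ B = φ.countingMeasure (B ∩ shell d M n) := by
      intro n
      obtain ⟨k, hk⟩ := shell_count φ n
      rw [tsum_eq_single k]
      · rcases shellKernel_apply (n, k) φ with ⟨h, h'⟩ | ⟨h, h'⟩
        · rw [h', Measure.restrict_apply hB]
        · exact absurd hk h
      · intro k' hk'
        rcases shellKernel_apply (n, k') φ with ⟨h, h'⟩ | ⟨h, h'⟩
        · rw [hk] at h
          exact absurd (by exact_mod_cast h.symm) hk'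
        · simp [h']
    simp_rw [h1]
    rw [← measure_iUnion]
    · have : ⋃ n, B ∩ shell d M n = B := by
        ext p
        simp [shell]
      rw [this]
      rfl
    · intro a b hab
      refine Set.disjoint_left.2 fun p hp hq => hab ?_
      exact (show ⌊‖p.1‖⌋₊ = a from hp.2).symm.trans hq.2
    · exact fun n => hB.inter (measurableSet_shell n)
  rw [hsum]
  infer_instance

lemma countingMeasure_shift (y : EuclideanSpace ℝ (Fin d)) (φ : MarkedConfig d M) :
    (φ.shift y).countingMeasure = φ.countingMeasure.map (fun p => (p.1 - y, p.2)) := by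
  ext B hB
  have hm : Measurable fun p : EuclideanSpace ℝ (Fin d) × M => (p.1 - y, p.2) := by fun_prop
  rw [Measure.map_apply hm hB, countingMeasure_apply _ hB, countingMeasure_apply _ (hm hB)]
  have hinj : Function.Injective fun p : EuclideanSpace ℝ (Fin d) × M => (p.1 - y, p.2) := by
    rintro ⟨a, b⟩ ⟨a', b'⟩ h
    simpa using h
  rw [← hinj.encard_image (φ.atoms ∩ _), Set.image_inter_preimage]
  rfl

/-- Shifting is jointly measurable. -/
lemma measurable_shift :
    Measurable fun a : EuclideanSpace ℝ (Fin d) × MarkedConfig d M => a.2.shift a.1 := by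
  refine measurable_of_count fun B hB => ?_
  let κ : Kernel (EuclideanSpace ℝ (Fin d) × MarkedConfig d M) (EuclideanSpace ℝ (Fin d) × M) :=
    (countingKernel d M).comap Prod.snd measurable_snd
  have h : ∀ a : EuclideanSpace ℝ (Fin d) × MarkedConfig d M,
      (a.2.shift a.1).countingMeasure B = ∫⁻ p, B.indicator 1 (p.1 - a.1, p.2)
        ∂(κ a) := by
    intro a
    have hm : Measurable fun p : EuclideanSpace ℝ (Fin d) × M => (p.1 - a.1, p.2) := by fun_prop
    rw [countingMeasure_shift, ← lintegral_indicator_one hB,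
      lintegral_map (measurable_one.indicator hB) hm]
    rfl
  simp_rw [h]
  refine Measurable.lintegral_kernel_prod_right ?_
  refine (measurable_one.indicator hB).comp ?_
  fun_prop

lemma measurableSet_unitCube : MeasurableSet (unitCube d) := by
  have : unitCube d = ⋂ i, (fun x : EuclideanSpace ℝ (Fin d) => x i) ⁻¹' Set.Icc (0 : ℝ) 1 := by
    ext x
    simp [unitCube]
  rw [this]
  exact MeasurableSet.iInter fun i => measurableSet_Icc.preimage (by fun_prop)

/-- The number of atoms in the unit cube whose recentered configuration lies in `A` is a
measurable function of the configuration. -/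
lemma measurable_palmCount {A : Set (PalmConfig d M)} (hA : MeasurableSet A) :
    Measurable fun φ : MarkedConfig d M =>
      ∑' p : φ.cubeAtoms, A.indicator (1 : PalmConfig d M → ℝ≥0∞) (φ.recenter p.1) := by
  obtain ⟨B, hB, rfl⟩ := hA
  let F : MarkedConfig d M → EuclideanSpace ℝ (Fin d) × M → ℝ≥0∞ := fun φ p =>
    (unitCube d).indicator 1 p.1 * B.indicator 1 (φ.shift p.1)
  have hF : Measurable (Function.uncurry F) := by
    refine Measurable.mul ?_ ?_
    · exact (measurable_one.indicator measurableSet_unitCube).comp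
        (measurable_fst.comp measurable_snd)
    · exact (measurable_one.indicator hB).comp
        (measurable_shift.comp ((measurable_fst.comp measurable_snd).prodMk measurable_fst))
  have h : ∀ φ : MarkedConfig d M,
      ∑' p : φ.cubeAtoms, (Subtype.val ⁻¹' B : Set (PalmConfig d M)).indicator
        (1 : PalmConfig d M → ℝ≥0∞) (φ.recenter p.1) = ∫⁻ p, F φ p ∂(countingKernel d M φ) := by
    intro φ
    have hFφ : Measurable (F φ) := hF.comp measurable_prodMk_left
    change _ = ∫⁻ p, F φ p ∂φ.countingMeasure
    rw [lintegral_countingMeasure φ hFφ, tsum_subtype φ.cubeAtoms (fun p =>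
      (Subtype.val ⁻¹' B : Set (PalmConfig d M)).indicator (1 : PalmConfig d M → ℝ≥0∞) (φ.recenter p))]
    refine tsum_congr fun p => ?_
    by_cases hp : p.1.1 ∈ unitCube d
    · have hp' : p ∈ φ.cubeAtoms := hp
      simp only [Set.indicator_of_mem hp', F, Set.indicator_of_mem hp, Pi.one_apply, one_mul]
      rfl
    · have hp' : p ∉ φ.cubeAtoms := hp
      simp [Set.indicator_of_notMem hp', F, Set.indicator_of_notMem hp]
  simp_rw [h]
  exact Measurable.lintegral_kernel_prod_right hF

end MarkedConfig

end Measurability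

section OptimalMarkings

variable {d : ℕ} {M : Type*} [MeasurableSpace M]

/-- The intensity `λ = E #(Φ ∩ ([0,1]^d × M))`, where `P` is the law of `Φ`. -/
noncomputable def intensity (P : Measure (MarkedConfig d M)) : ℝ≥0∞ :=
  ∫⁻ φ, (φ.cubeAtoms.encard : ℝ≥0∞) ∂P

/-- The Palm probability
`P⁰(A) = λ⁻¹ E[∑_{X_i ∈ [0,1]^d} 1(S_{X_i} Φ ∈ A)]`, where `P` is the law of `Φ`. -/
noncomputable def palm (P : Measure (MarkedConfig d M)) : Measure (PalmConfig d M) :=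
  Measure.ofMeasurable
    (fun A _ => (intensity P)⁻¹ *
      ∫⁻ φ, ∑' p : φ.cubeAtoms, A.indicator (1 : PalmConfig d M → ℝ≥0∞) (φ.recenter p.1) ∂P)
    (by simp)
    (by
      intro A hA hdisj
      rw [ENNReal.tsum_mul_left,
        ← lintegral_tsum fun i => (MarkedConfig.measurable_palmCount (hA i)).aemeasurable]
      congr 1
      refine lintegral_congr fun φ => ?_
      rw [ENNReal.tsum_comm]
      refine tsum_congr fun p => ?_
      have hd : ∀ B : Set (PalmConfig d M), MeasurableSet B → B.indicator
          (1 : PalmConfig d M → ℝ≥0∞) (φ.recenter p.1) = Measure.dirac (φ.recenter p.1) B :=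
        fun B hB => (Measure.dirac_apply' _ hB).symm
      simp_rw [hd _ (MeasurableSet.iUnion hA), fun i => hd _ (hA i)]
      exact measure_iUnion hdisj hA)

/-- A measure on configurations is stationary if it is invariant under all shifts. -/
def Stationary (P : Measure (MarkedConfig d M)) : Prop :=
  ∀ y : EuclideanSpace ℝ (Fin d), MeasurePreserving (MarkedConfig.shift y) P P

/-- `T(Φ)`: the laws of the stationary `[0, ∞)`-markings of a point process with law `P`. -/
def stationaryMarkings (P : Measure (MarkedConfig d M)) :
    Set (Measure (MarkedConfig d (M × ℝ≥0))) :=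
  {Q | IsProbabilityMeasure Q ∧ Stationary Q ∧ MeasurePreserving MarkedConfig.proj Q P}

/-- The `ξ`-intensity `γ_ξ(Ψ) = E[∑_{X_i ∈ [0,1]^d} ξ(S_{X_i} Ψ)]`, where `Q` is the law
of `Ψ`. -/
noncomputable def scoreIntensity (ξ : PalmConfig d (M × ℝ≥0) → EReal)
    (Q : Measure (MarkedConfig d (M × ℝ≥0))) : EReal :=
  eexpect Q fun ψ => esum fun q : ψ.cubeAtoms => ξ (ψ.recenter q.1)

/-- The optimal `ξ`-intensity `γ_{ξ,opt}` over all stationary markings. -/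
noncomputable def optIntensity (ξ : PalmConfig d (M × ℝ≥0) → EReal)
    (P : Measure (MarkedConfig d M)) : EReal :=
  ⨆ Q ∈ stationaryMarkings P, scoreIntensity ξ Q

/-- `Q` is the law of an intensity-optimal stationary marking. -/
def IsIntensityOptimal (ξ : PalmConfig d (M × ℝ≥0) → EReal)
    (P : Measure (MarkedConfig d M)) (Q : Measure (MarkedConfig d (M × ℝ≥0))) : Prop :=
  Q ∈ stationaryMarkings P ∧ scoreIntensity ξ Q = optIntensity ξ P

/-- `Q` is the law of an intensity-optimal stationary marking, and every intensity-optimal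
stationary marking has this law. -/
def IsUniqueIntensityOptimal (ξ : PalmConfig d (M × ℝ≥0) → EReal)
    (P : Measure (MarkedConfig d M)) (Q : Measure (MarkedConfig d (M × ℝ≥0))) : Prop :=
  IsIntensityOptimal ξ P Q ∧ ∀ Q', IsIntensityOptimal ξ P Q' → Q' = Q

/-- The additive score `ξ(Ψ) = ∑_i H(X_i, M'_i, S_{X_i} Φ)` with `Φ = π(Ψ)`. -/
noncomputable def additiveScore
    (H : EuclideanSpace ℝ (Fin d) → ℝ≥0 → PalmConfig d M → EReal)
    (ψ : PalmConfig d (M × ℝ≥0)) : EReal :=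
  esum fun q : ψ.1.atoms =>
    H q.1.1 q.1.2.2 (ψ.1.proj.recenter ⟨(q.1.1, q.1.2.1), q.1, q.2, rfl⟩)

/-- `f(m', φ) = ∑_{x ∈ φ} H(-x, m', φ)`. -/
noncomputable def transportedScore
    (H : EuclideanSpace ℝ (Fin d) → ℝ≥0 → PalmConfig d M → EReal)
    (m : ℝ≥0) (φ : PalmConfig d M) : EReal :=
  esum fun p : φ.1.atoms => H (-p.1.1) m φ

/-- `argmax_{m' ≥ 0} f(m', φ)`, as a set. -/
def argmaxSet (H : EuclideanSpace ℝ (Fin d) → ℝ≥0 → PalmConfig d M → EReal)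
    (φ : PalmConfig d M) : Set ℝ≥0 :=
  {m | ∀ m', transportedScore H m' φ ≤ transportedScore H m φ}

/-- The mark `argmax_{m' ≥ 0} f(m', φ)`, read as the smallest maximizer if there are several
(and as `0` if there is none). -/
noncomputable def argmaxMark (H : EuclideanSpace ℝ (Fin d) → ℝ≥0 → PalmConfig d M → EReal)
    (φ : PalmConfig d M) : ℝ≥0 :=
  sInf (argmaxSet H φ)

/-- The law of the marking `M'_i = argmax_{m' ≥ 0} f(m', S_{X_i} Φ)`. -/
noncomputable def argmaxMarkingLaw
    (H : EuclideanSpace ℝ (Fin d) → ℝ≥0 → PalmConfig d M → EReal)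
    (P : Measure (MarkedConfig d M)) : Measure (MarkedConfig d (M × ℝ≥0)) :=
  P.map (MarkedConfig.markBy (argmaxMark H))

end OptimalMarkings

/-! The mass transport principle turns the score intensity into a Palm integral. The origin receives
`H(X_i, M'_i, S_{X_i}Φ)` from each point. By stationarity, the expected amount received by the
points of the unit cube equals the expected amount they send, and a point with mark `m'` that sees
`φ` sends `f(m', φ)`. Hence `γ_ξ(Ψ) = λ E⁰[f(M'_0, Φ)]` (`scoreIntensity_additiveScore`), an
integral over the Palm measure of `Ψ`, whose projection to configurations is the same for all
competitors. Optimising the marking is thus maximising `f(·, φ)` for Palm-almost every `φ`.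

If the maximizer is unique, marking by it is optimal. Since the optimal value is finite, any other
optimal marking attains the maximum Palm-a.s., so its marks are the maximizers, at the typical point
and hence at every point, which fixes its law.

Conversely, let the argmax marking be the unique optimum. It is at least as good as each constant
mark, Palm-a.s., since otherwise switching on the set where the constant is better would raise a
finite optimum; constants from a dense set and continuity show that its mark is a maximizer. For
each `t`, using the smallest maximizer in `[t, ∞)` wherever there is one gives another optimal
marking, so it must agree with the original. Letting `t` run through a dense set rules out a second
maximizer. -/

/-! ### Sums and expectations of extended real variables. -/

section ExtendedExpectation

lemma EReal.toENNReal_coe_sub_coe_of_zero_or_top {u v : ℝ≥0∞} (hv : v = 0 ∨ v = ⊤) :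
    (-((u : EReal) - (v : EReal))).toENNReal = v := by
  rcases hv with rfl | rfl
  · simp
  · simp

/-- Sums are expectations for the counting measure, so `esum_sub` is an instance of `eexpect_sub`.
-/
lemma esum_eq_eexpect_count {ι : Type*} (a : ι → EReal) :
    esum a = @eexpect ι ⊤ (@Measure.count ι ⊤) a := by
  let _ : MeasurableSpace ι := ⊤
  rw [eexpect, esum, lintegral_count, lintegral_count]

/-- Without a hypothesis, cancellation would make the positive part of `U - V` smaller than `U`. If
`V` is `{0, ⊤}`-valued, the negative part is exactly `V`, also where `U = ⊤`; then either `V = 0`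
almost everywhere or both sides are `⊥`. -/
lemma eexpect_sub {Ω : Type*} [MeasurableSpace Ω] {μ : Measure Ω} {U V : Ω → ℝ≥0∞}
    (hV : Measurable V) (h : (∀ ω, V ω = 0 ∨ V ω = ⊤) ∨ ∀ ω, U ω = 0) :
    eexpect μ (fun ω => (U ω : EReal) - (V ω : EReal)) =
      ((∫⁻ ω, U ω ∂μ : ℝ≥0∞) : EReal) - ((∫⁻ ω, V ω ∂μ : ℝ≥0∞) : EReal) := by
  rcases h with h | h
  · simp only [eexpect, EReal.toENNReal_coe_sub_coe_of_zero_or_top (h _)]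
    by_cases hT : ∫⁻ ω, V ω ∂μ = ⊤
    · simp [hT]
    · have h0 : ∀ᵐ ω ∂μ, V ω = 0 := by
        filter_upwards [ae_lt_top hV hT] with ω hω
        exact (h ω).resolve_right hω.ne
      rw [lintegral_congr_ae (g := U)]
      filter_upwards [h0] with ω hω
      simp [hω]
  · have h1 : ∀ ω, ((U ω : EReal) - (V ω : EReal)).toENNReal = 0 := fun ω => by
      rw [h, EReal.toENNReal_of_nonpos (by simp [EReal.coe_ennreal_nonneg])]
    have h2 : ∀ ω, (-((U ω : EReal) - (V ω : EReal))).toENNReal = V ω := fun ω => by simp [h]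
    simp only [eexpect, h1, h2]
    simp [h]

lemma esum_sub {ι : Type*} {u v : ι → ℝ≥0∞} (h : (∀ i, v i = 0 ∨ v i = ⊤) ∨ ∀ i, u i = 0) :
    esum (fun i => (u i : EReal) - (v i : EReal)) =
      ((∑' i, u i : ℝ≥0∞) : EReal) - ((∑' i, v i : ℝ≥0∞) : EReal) := by
  let _ : MeasurableSpace ι := ⊤
  rw [esum_eq_eexpect_count, eexpect_sub measurable_from_top h, lintegral_count, lintegral_count]

lemma ENNReal.tsum_eq_zero_or_top {ι : Type*} {v : ι → ℝ≥0∞} (h : ∀ i, v i = 0 ∨ v i = ⊤) :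
    ∑' i, v i = 0 ∨ ∑' i, v i = ⊤ := by
  by_cases h' : ∀ i, v i = 0
  · left; simp [h']
  · push Not at h'
    obtain ⟨i, hi⟩ := h'
    exact .inr (ENNReal.tsum_eq_top_of_eq_top ⟨i, (h i).resolve_left hi⟩)

lemma eexpect_mono {Ω : Type*} [MeasurableSpace Ω] {μ : Measure Ω} {X Y : Ω → EReal}
    (h : ∀ᵐ ω ∂μ, X ω ≤ Y ω) : eexpect μ X ≤ eexpect μ Y := by
  refine EReal.sub_le_sub ?_ ?_
  · exact EReal.coe_ennreal_le_coe_ennreal_iff.2 (lintegral_mono_ae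
      (h.mono fun ω hω => EReal.toENNReal_le_toENNReal hω))
  · exact EReal.coe_ennreal_le_coe_ennreal_iff.2 (lintegral_mono_ae
      (h.mono fun ω hω => EReal.toENNReal_le_toENNReal (EReal.neg_le_neg_iff.2 hω)))

lemma eexpect_map {Ω Ω' : Type*} [MeasurableSpace Ω] [MeasurableSpace Ω'] {μ : Measure Ω}
    {T : Ω → Ω'} (hT : Measurable T) {X : Ω' → EReal} (hX : Measurable X) :
    eexpect (μ.map T) X = eexpect μ (fun ω => X (T ω)) := by
  rw [eexpect, eexpect, lintegral_map (by fun_prop) hT, lintegral_map (by fun_prop) hT]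

lemma EReal.eq_of_toENNReal_eq {x y : EReal} (h : x.toENNReal = y.toENNReal)
    (h' : (-x).toENNReal = (-y).toENNReal) : x = y := by
  rcases le_total 0 x with hx | hx <;> rcases le_total 0 y with hy | hy
  · rw [← EReal.coe_toENNReal hx, ← EReal.coe_toENNReal hy, h]
  · rw [EReal.toENNReal_of_nonpos hy, EReal.toENNReal_eq_zero_iff] at h
    rw [EReal.toENNReal_of_nonpos (x := -x) (by simpa using hx), eq_comm,
      EReal.toENNReal_eq_zero_iff] at h'
    rw [le_antisymm h hx, le_antisymm hy (by simpa using h')]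
  · rw [EReal.toENNReal_of_nonpos hx, eq_comm, EReal.toENNReal_eq_zero_iff] at h
    rw [EReal.toENNReal_of_nonpos (x := -y) (by simpa using hy),
      EReal.toENNReal_eq_zero_iff] at h'
    rw [le_antisymm h hy, le_antisymm hx (by simpa using h')]
  · have hx' : 0 ≤ -x := by simpa using hx
    have hy' : 0 ≤ -y := by simpa using hy
    rw [← neg_inj, ← EReal.coe_toENNReal hx', ← EReal.coe_toENNReal hy', h']

lemma lintegral_ne_top_of_eexpect {Ω : Type*} [MeasurableSpace Ω] {μ : Measure Ω} {X : Ω → EReal}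
    (hb : eexpect μ X ≠ ⊥) (ht : eexpect μ X ≠ ⊤) :
    ∫⁻ ω, (X ω).toENNReal ∂μ ≠ ⊤ ∧ ∫⁻ ω, (-X ω).toENNReal ∂μ ≠ ⊤ := by
  have h2 : ∫⁻ ω, (-X ω).toENNReal ∂μ ≠ ⊤ := by
    intro h
    exact hb (by simp [eexpect, h])
  refine ⟨fun h => ht ?_, h2⟩
  rw [eexpect, h]
  lift ∫⁻ ω, (-X ω).toENNReal ∂μ to ℝ≥0 using h2 with b
  exact EReal.top_sub_coe _

/-- The equality case of monotonicity. A finite expectation makes all four integrals finite.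
Positive parts increase and negative parts decrease from `X` to `Y`, so equal differences force
equality of both pairs. -/
lemma ae_eq_of_eexpect_eq {Ω : Type*} [MeasurableSpace Ω] {μ : Measure Ω} {X Y : Ω → EReal}
    (hX : Measurable X) (hY : Measurable Y) (h : ∀ᵐ ω ∂μ, X ω ≤ Y ω)
    (he : eexpect μ X = eexpect μ Y) (hb : eexpect μ X ≠ ⊥) (ht : eexpect μ X ≠ ⊤) :
    X =ᵐ[μ] Y := by
  obtain ⟨hX1, hX2⟩ := lintegral_ne_top_of_eexpect hb ht
  obtain ⟨hY1, hY2⟩ := lintegral_ne_top_of_eexpect (he ▸ hb) (he ▸ ht)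
  have hp : ∀ᵐ ω ∂μ, (X ω).toENNReal ≤ (Y ω).toENNReal :=
    h.mono fun ω hω => EReal.toENNReal_le_toENNReal hω
  have hn : ∀ᵐ ω ∂μ, (-Y ω).toENNReal ≤ (-X ω).toENNReal :=
    h.mono fun ω hω => EReal.toENNReal_le_toENNReal (EReal.neg_le_neg_iff.2 hω)
  have ip := lintegral_mono_ae hp
  have i_n := lintegral_mono_ae hn
  have key : ∫⁻ ω, (Y ω).toENNReal ∂μ ≤ ∫⁻ ω, (X ω).toENNReal ∂μ ∧
      ∫⁻ ω, (-X ω).toENNReal ∂μ ≤ ∫⁻ ω, (-Y ω).toENNReal ∂μ := by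
    unfold eexpect at he
    lift ∫⁻ ω, (X ω).toENNReal ∂μ to ℝ≥0 using hX1 with a
    lift ∫⁻ ω, (-X ω).toENNReal ∂μ to ℝ≥0 using hX2 with b
    lift ∫⁻ ω, (Y ω).toENNReal ∂μ to ℝ≥0 using hY1 with a'
    lift ∫⁻ ω, (-Y ω).toENNReal ∂μ to ℝ≥0 using hY2 with b'
    have he' : (a : ℝ) - b = a' - b' := by
      have h3 : (((a : ℝ) - b : ℝ) : EReal) = ((a' - b' : ℝ) : EReal) := he
      exact_mod_cast h3
    have i1 : (a : ℝ) ≤ a' := by exact_mod_cast ip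
    have i2 : (b' : ℝ) ≤ b := by exact_mod_cast i_n
    have j1 : (a' : ℝ) ≤ a := by linarith
    have j2 : (b : ℝ) ≤ b' := by linarith
    exact ⟨by exact_mod_cast j1, by exact_mod_cast j2⟩
  filter_upwards [ae_eq_of_ae_le_of_lintegral_le hp hX1 (by fun_prop) key.1,
    ae_eq_of_ae_le_of_lintegral_le hn hY2 (by fun_prop) key.2] with ω h1 h2
  exact EReal.eq_of_toENNReal_eq h1 h2.symm

end ExtendedExpectation

/-! ### Stationarity and exchange of base points. -/

section MassTransport

lemma volume_unitCube (d : ℕ) : volume (unitCube d) = 1 := by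
  have h : unitCube d = (MeasurableEquiv.toLp 2 (Fin d → ℝ)).symm ⁻¹'
      (Set.Icc (0 : Fin d → ℝ) 1) := by
    ext x
    simp only [unitCube, Set.mem_ofPred_eq, Set.mem_preimage, Set.mem_Icc, Pi.le_def]
    exact forall_and
  rw [h, (EuclideanSpace.volume_preserving_symm_measurableEquiv_toLp (Fin d)).measure_preimage
    measurableSet_Icc.nullMeasurableSet, Real.volume_Icc_pi]
  simp

/-- The indicator function of the unit cube. -/
noncomputable def cubeInd (d : ℕ) : EuclideanSpace ℝ (Fin d) → ℝ≥0∞ := (unitCube d).indicator 1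

@[fun_prop]
lemma measurable_cubeInd {d : ℕ} : Measurable (cubeInd d) :=
  measurable_one.indicator MarkedConfig.measurableSet_unitCube

lemma lintegral_cubeInd (d : ℕ) : ∫⁻ y, cubeInd d y = 1 := by
  rw [cubeInd, lintegral_indicator_one MarkedConfig.measurableSet_unitCube, volume_unitCube]

lemma lintegral_cubeInd_add {d : ℕ} (x : EuclideanSpace ℝ (Fin d)) :
    ∫⁻ y, cubeInd d (x + y) = 1 := by
  rw [lintegral_add_left_eq_self (cubeInd d) x, lintegral_cubeInd]

lemma lintegral_cubeInd_sub {d : ℕ} (x : EuclideanSpace ℝ (Fin d)) :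
    ∫⁻ y, cubeInd d (x - y) = 1 := by
  rw [lintegral_sub_left_eq_self (cubeInd d) x, lintegral_cubeInd]

variable {d : ℕ} {N Y : Type*} [MeasurableSpace N] [MeasurableSpace Y]

/-- Equivariance of `ν` makes `Q ⊗ₘ ν` invariant under the joint shift. -/
lemma Stationary.lintegral_compProd_shift {Q : Measure (MarkedConfig d N)} [SFinite Q]
    (hQ : Stationary Q) {ν : Kernel (MarkedConfig d N) Y} [IsSFiniteKernel ν]
    {T : EuclideanSpace ℝ (Fin d) → Y → Y} (y : EuclideanSpace ℝ (Fin d)) (hT : Measurable (T y))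
    (hν : ∀ ψ, ν (ψ.shift y) = (ν ψ).map (T y))
    {F : MarkedConfig d N × Y → ℝ≥0∞} (hF : Measurable F) :
    ∫⁻ z, F (z.1.shift y, T y z.2) ∂(Q ⊗ₘ ν) = ∫⁻ z, F z ∂(Q ⊗ₘ ν) := by
  have hs := (hQ y).measurable
  have hi : Measurable fun ψ => ∫⁻ z, F (ψ, z) ∂(ν ψ) :=
    Measurable.lintegral_kernel_prod_right (f := fun ψ z => F (ψ, z)) hF
  rw [Measure.lintegral_compProd hF, Measure.lintegral_compProd (by fun_prop),
    ← (hQ y).lintegral_comp hi]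
  refine lintegral_congr fun ψ => ?_
  rw [hν, lintegral_map (by fun_prop) hT]

/-- If `a` and `b` move with the configuration and `G` is invariant under simultaneous shifts, then
`G` has the same integral over `a ∈ [0,1]^d` as over `b ∈ [0,1]^d`. -/
theorem Stationary.lintegral_unitCube_exchange {Q : Measure (MarkedConfig d N)} [SFinite Q]
    (hQ : Stationary Q) {ν : Kernel (MarkedConfig d N) Y} [IsSFiniteKernel ν]
    {T : EuclideanSpace ℝ (Fin d) → Y → Y} (hT : ∀ y, Measurable (T y))
    (hν : ∀ y ψ, ν (ψ.shift y) = (ν ψ).map (T y))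
    {a b : Y → EuclideanSpace ℝ (Fin d)} (ha : Measurable a) (hb : Measurable b)
    (haT : ∀ y z, a (T y z) = a z - y) (hbT : ∀ y z, b (T y z) = b z - y)
    {G : MarkedConfig d N × Y → ℝ≥0∞} (hG : Measurable G)
    (hGT : ∀ y ψ z, G (ψ.shift y, T y z) = G (ψ, z)) :
    ∫⁻ z, cubeInd d (a z.2) * G z ∂(Q ⊗ₘ ν) =
      ∫⁻ z, cubeInd d (b z.2) * G z ∂(Q ⊗ₘ ν) := by
  calc
    -- Inserts the factor `∫ cubeInd (b - y) dy = 1`.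
    _ = ∫⁻ z, (∫⁻ y, cubeInd d (a z.2) *
          cubeInd d (b z.2 - y) * G z) ∂(Q ⊗ₘ ν) := by
        refine lintegral_congr fun z => ?_
        rw [lintegral_mul_const _ (by fun_prop), lintegral_const_mul _ (by fun_prop),
          lintegral_cubeInd_sub, mul_one]
    _ = ∫⁻ y, ∫⁻ z, cubeInd d (a z.2) *
          cubeInd d (b z.2 - y) * G z ∂(Q ⊗ₘ ν) :=
        lintegral_lintegral_swap (by fun_prop)
    -- Invariance under the shift by `y` replaces `a` by `a + y` and `b - y` by `b`; now the factor
    -- in `a` integrates to `1` over `y`.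
    _ = ∫⁻ y, ∫⁻ z, cubeInd d (a z.2 + y) *
          cubeInd d (b z.2) * G z ∂(Q ⊗ₘ ν) := by
        refine lintegral_congr fun y => ?_
        rw [← hQ.lintegral_compProd_shift y (hT y) (hν y) (F := fun z =>
          cubeInd d (a z.2 + y) * cubeInd d (b z.2) * G z)
          (by fun_prop)]
        simp only [haT, hbT, hGT, sub_add_cancel]
    _ = ∫⁻ z, (∫⁻ y, cubeInd d (a z.2 + y) *
          cubeInd d (b z.2) * G z) ∂(Q ⊗ₘ ν) :=
        (lintegral_lintegral_swap (by fun_prop)).symm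
    _ = _ := by
        refine lintegral_congr fun z => ?_
        rw [lintegral_mul_const _ (by fun_prop), lintegral_mul_const _ (by fun_prop),
          lintegral_cubeInd_add, one_mul]

/-- All translates of the unit cube carry the same mass, and averaging over them recovers the total
integral. It carries null sets from the atoms in the cube to all atoms. -/
theorem Stationary.lintegral_eq_zero {Q : Measure (MarkedConfig d N)} [SFinite Q]
    (hQ : Stationary Q) {ν : Kernel (MarkedConfig d N) Y} [IsSFiniteKernel ν]
    {T : EuclideanSpace ℝ (Fin d) → Y → Y} (hT : ∀ y, Measurable (T y))
    (hν : ∀ y ψ, ν (ψ.shift y) = (ν ψ).map (T y))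
    {a : Y → EuclideanSpace ℝ (Fin d)} (ha : Measurable a)
    (haT : ∀ y z, a (T y z) = a z - y)
    {G : MarkedConfig d N × Y → ℝ≥0∞} (hG : Measurable G)
    (hGT : ∀ y ψ z, G (ψ.shift y, T y z) = G (ψ, z))
    (h0 : ∫⁻ z, cubeInd d (a z.2) * G z ∂(Q ⊗ₘ ν) = 0) :
    ∫⁻ z, G z ∂(Q ⊗ₘ ν) = 0 := by
  calc
    _ = ∫⁻ z, (∫⁻ y, cubeInd d (a z.2 - y) * G z) ∂(Q ⊗ₘ ν) := by
        refine lintegral_congr fun z => ?_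
        rw [lintegral_mul_const _ (by fun_prop), lintegral_cubeInd_sub, one_mul]
    _ = ∫⁻ y, ∫⁻ z, cubeInd d (a z.2 - y) * G z ∂(Q ⊗ₘ ν) :=
        lintegral_lintegral_swap (by fun_prop)
    _ = ∫⁻ y, ∫⁻ z, cubeInd d (a z.2) * G z ∂(Q ⊗ₘ ν) := by
        refine lintegral_congr fun y => ?_
        rw [← hQ.lintegral_compProd_shift y (hT y) (hν y) (F := fun z =>
          cubeInd d (a z.2) * G z) (by fun_prop)]
        simp only [haT, hGT]
    _ = 0 := by simp [h0]

namespace MarkedConfig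

lemma countingKernel_apply (ψ : MarkedConfig d N) : countingKernel d N ψ = ψ.countingMeasure := rfl

/-- The displacement of an atom by `-y`. -/
def shiftAtom (y : EuclideanSpace ℝ (Fin d)) (q : EuclideanSpace ℝ (Fin d) × N) :
    EuclideanSpace ℝ (Fin d) × N := (q.1 - y, q.2)

lemma measurable_shiftAtom (y : EuclideanSpace ℝ (Fin d)) :
    Measurable (shiftAtom (N := N) y) := by
  unfold shiftAtom; fun_prop

lemma ae_forall_atoms {Q : Measure (MarkedConfig d N)} [SFinite Q] (hQ : Stationary Q)
    {A : Set (MarkedConfig d N × (EuclideanSpace ℝ (Fin d) × N))} (hA : MeasurableSet A)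
    (hAT : ∀ y ψ q, (shift y ψ, shiftAtom y q) ∈ A ↔ (ψ, q) ∈ A)
    (h0 : ∀ᵐ z ∂(Q ⊗ₘ countingKernel d N), z.2.1 ∈ unitCube d → z ∈ A) :
    ∀ᵐ ψ ∂Q, ∀ q ∈ ψ.atoms, (ψ, q) ∈ A := by
  have hG : Measurable (Aᶜ.indicator
      (1 : MarkedConfig d N × (EuclideanSpace ℝ (Fin d) × N) → ℝ≥0∞)) := measurable_one.indicator hA.compl
  have h1 := hQ.lintegral_eq_zero (ν := countingKernel d N) (T := shiftAtom)
    measurable_shiftAtom (fun y ψ => countingMeasure_shift y ψ) measurable_fst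
    (fun y z => rfl) hG (fun y ψ z => by
      by_cases h : (ψ, z) ∈ A
      · simp [h, (hAT y ψ z).2 h]
      · have h' : (ψ.shift y, shiftAtom y z) ∉ A := fun h' => h ((hAT y ψ z).1 h')
        simp [h, h']) (by
      rw [lintegral_eq_zero_iff']
      · filter_upwards [h0] with z hz
        by_cases h : z.2.1 ∈ unitCube d
        · simp [hz h]
        · simp [cubeInd, h]
      · fun_prop)
  rw [Measure.lintegral_compProd hG, lintegral_eq_zero_iff
    (Measurable.lintegral_kernel_prod_right (f := fun ψ z => Aᶜ.indicator 1 (ψ, z)) hG)] at h1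
  filter_upwards [h1] with ψ hψ q hq
  rw [countingKernel_apply, lintegral_countingMeasure _ (by fun_prop), Pi.zero_apply,
    ENNReal.tsum_eq_zero] at hψ
  by_contra h
  simpa [h] using hψ ⟨q, hq⟩

end MarkedConfig

end MassTransport

/-! ### Equivariance and measurability of projection and marking. -/

section Configurations

namespace MarkedConfig

variable {d : ℕ} {M N : Type*}

lemma shift_shift (y z : EuclideanSpace ℝ (Fin d)) (φ : MarkedConfig d M) :
    (φ.shift y).shift z = φ.shift (y + z) := by
  ext p
  simp [shift, Set.image_image, sub_sub]

lemma proj_shift {M' : Type*} (y : EuclideanSpace ℝ (Fin d)) (ψ : MarkedConfig d (M × M')) :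
    (ψ.shift y).proj = ψ.proj.shift y := by
  ext p
  simp [shift, proj, Set.image_image]

lemma proj_markBy {M' : Type*} (g : PalmConfig d M → M') (φ : MarkedConfig d M) :
    (φ.markBy g).proj = φ := by
  ext p
  simp [proj, markBy, ← Set.range_comp, Function.comp_def]

lemma markBy_shift {M' : Type*} (g : MarkedConfig d M → M') (y : EuclideanSpace ℝ (Fin d))
    (φ : MarkedConfig d M) :
    (φ.shift y).markBy (fun φ => g φ.1) = (φ.markBy fun φ => g φ.1).shift y := by
  ext p
  constructor
  · rintro ⟨⟨_, q, hq, rfl⟩, rfl⟩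
    refine ⟨_, ⟨⟨q, hq⟩, rfl⟩, ?_⟩
    simp [recenter, shift_shift]
  · rintro ⟨_, ⟨⟨q, hq⟩, rfl⟩, rfl⟩
    refine ⟨⟨_, q, hq, rfl⟩, ?_⟩
    simp [recenter, shift_shift]

/-- A configuration with marks `g (S_x φ)` is the marking of its projection by `g`. -/
lemma eq_markBy_proj {M' : Type*} {g : PalmConfig d M → M'} {ψ : MarkedConfig d (M × M')}
    (h : ∀ q, ∀ hq : q ∈ ψ.atoms,
      q.2.2 = g (ψ.proj.recenter ⟨(q.1, q.2.1), q, hq, rfl⟩)) :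
    ψ = ψ.proj.markBy g := by
  ext p
  constructor
  · intro hp
    refine ⟨⟨(p.1, p.2.1), p, hp, rfl⟩, ?_⟩
    change (p.1, p.2.1, g _) = p
    rw [← h p hp]
  · rintro ⟨⟨_, q, hq, rfl⟩, rfl⟩
    change (q.1, q.2.1, g _) ∈ _
    rw [← h q hq]
    exact hq

variable [MeasurableSpace M] [MeasurableSpace N]

@[fun_prop]
lemma _root_.Measurable.markedConfig_shift {α : Type*} [MeasurableSpace α]
    {y : α → EuclideanSpace ℝ (Fin d)} {φ : α → MarkedConfig d M} (hy : Measurable y)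
    (hφ : Measurable φ) : Measurable fun a => (φ a).shift (y a) :=
  measurable_shift.comp (hy.prodMk hφ)

lemma measurable_shift_const (y : EuclideanSpace ℝ (Fin d)) :
    Measurable (shift (M := M) y) :=
  by fun_prop

/-- Injectivity on the atoms prevents merging, which would make the image measure count
multiplicities. For projections and markings it comes from simplicity. -/
lemma countingMeasure_eq_map {φ : MarkedConfig d M} {ψ : MarkedConfig d N}
    {T : EuclideanSpace ℝ (Fin d) × M → EuclideanSpace ℝ (Fin d) × N} (hT : Measurable T)
    (hinj : Set.InjOn T φ.atoms) (himg : ψ.atoms = T '' φ.atoms) :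
    ψ.countingMeasure = φ.countingMeasure.map T := by
  ext B hB
  rw [Measure.map_apply hT hB, countingMeasure_apply _ hB, countingMeasure_apply _ (hT hB), himg,
    ← (hinj.mono Set.inter_subset_left).encard_image, Set.image_inter_preimage]

lemma countingMeasure_proj {M' : Type*} [MeasurableSpace M'] (ψ : MarkedConfig d (M × M')) :
    ψ.proj.countingMeasure = ψ.countingMeasure.map (fun q => (q.1, q.2.1)) :=
  countingMeasure_eq_map (by fun_prop)
    (fun p hp q hq h => ψ.simple p hp q hq (congrArg (fun z => z.1) h :)) rfl

lemma measurable_proj {M' : Type*} [MeasurableSpace M'] :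
    Measurable (proj : MarkedConfig d (M × M') → MarkedConfig d M) := by
  refine measurable_of_count fun B hB => ?_
  simp_rw [countingMeasure_proj]
  have hm : Measurable fun q : EuclideanSpace ℝ (Fin d) × M × M' => (q.1, q.2.1) := by fun_prop
  simp_rw [Measure.map_apply hm hB]
  exact Kernel.measurable_coe (countingKernel d (M × M')) (hm hB)

@[fun_prop]
lemma _root_.Measurable.markedConfig_proj {α M' : Type*} [MeasurableSpace α] [MeasurableSpace M']
    {ψ : α → MarkedConfig d (M × M')} (hψ : Measurable ψ) : Measurable fun a => (ψ a).proj :=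
  measurable_proj.comp hψ

lemma countingMeasure_markBy {M' : Type*} [MeasurableSpace M'] {g : MarkedConfig d M → M'}
    (hg : Measurable g) (φ : MarkedConfig d M) :
    (φ.markBy fun φ => g φ.1).countingMeasure =
      φ.countingMeasure.map (fun p => (p.1, p.2, g (φ.shift p.1))) := by
  refine countingMeasure_eq_map ?_
    (fun p hp q hq h => φ.simple p hp q hq (congrArg (fun z => z.1) h :)) ?_
  · fun_prop
  · ext p
    simp [markBy, recenter]

lemma measurable_markBy {M' : Type*} [MeasurableSpace M'] {g : MarkedConfig d M → M'}
    (hg : Measurable g) :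
    Measurable fun φ : MarkedConfig d M => φ.markBy fun φ => g φ.1 := by
  refine measurable_of_count fun B hB => ?_
  have hm : Measurable fun a : MarkedConfig d M × (EuclideanSpace ℝ (Fin d) × M) =>
      (a.2.1, a.2.2, g (a.1.shift a.2.1)) := by
    fun_prop
  have h : ∀ φ : MarkedConfig d M, (φ.markBy fun φ => g φ.1).countingMeasure B =
      ∫⁻ p, B.indicator 1 (p.1, p.2, g (φ.shift p.1)) ∂(countingKernel d M φ) := by
    intro φ
    rw [countingMeasure_markBy hg, ← lintegral_indicator_one hB, lintegral_map
      (measurable_one.indicator hB) (by fun_prop)]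
    rfl
  simp_rw [h]
  exact Measurable.lintegral_kernel_prod_right ((measurable_one.indicator hB).comp hm)

lemma measurableSet_palmConfig :
    MeasurableSet {φ : MarkedConfig d M | ∃ m, (0, m) ∈ φ.atoms} := by
  have hB : MeasurableSet (({0} : Set (EuclideanSpace ℝ (Fin d))) ×ˢ (Set.univ : Set M)) :=
    (measurableSet_singleton _).prod MeasurableSet.univ
  have h : {φ : MarkedConfig d M | ∃ m, (0, m) ∈ φ.atoms} =
      {φ | countingKernel d M φ ({0} ×ˢ Set.univ) = 0}ᶜ := by
    ext φ
    simp only [Set.mem_ofPred_eq, Set.mem_compl_iff, countingKernel_apply,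
      countingMeasure_apply _ hB]
    norm_cast
    rw [Set.encard_eq_zero, ← Ne, ← Set.nonempty_iff_ne_empty]
    constructor
    · rintro ⟨m, hm⟩
      exact ⟨(0, m), hm, by simp⟩
    · rintro ⟨⟨x, m⟩, hm, hx⟩
      obtain rfl : x = 0 := by simpa using hx
      exact ⟨m, hm⟩
  rw [h]
  exact (Kernel.measurable_coe _ hB (measurableSet_singleton 0)).compl

lemma tsum_cubeAtoms (φ : MarkedConfig d M) {F : EuclideanSpace ℝ (Fin d) × M → ℝ≥0∞}
    (hF : Measurable F) :
    ∑' p : φ.cubeAtoms, F p.1.1 = ∫⁻ p, cubeInd d p.1 * F p ∂φ.countingMeasure := by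
  rw [lintegral_countingMeasure _ (by fun_prop), tsum_subtype φ.cubeAtoms (fun p => F p.1)]
  refine tsum_congr fun p => ?_
  by_cases hp : p.1.1 ∈ unitCube d
  · rw [Set.indicator_of_mem (by exact hp)]
    simp [cubeInd, hp]
  · rw [Set.indicator_of_notMem (by exact hp)]
    simp [cubeInd, hp]

end MarkedConfig

end Configurations

/-! ### Palm measures of a process and of its markings. -/

section Palm

open MarkedConfig

variable {d : ℕ} {M N : Type*} [MeasurableSpace M] [MeasurableSpace N]

lemma measurable_lintegral_countingMeasure {F : MarkedConfig d N →
    EuclideanSpace ℝ (Fin d) × N → ℝ≥0∞} (hF : Measurable (Function.uncurry F)) :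
    Measurable fun ψ => ∫⁻ q, F ψ q ∂ψ.countingMeasure :=
  Measurable.lintegral_kernel_prod_right (κ := countingKernel d N) hF

/-- The Campbell measure `F ↦ E ∑_{X_i ∈ [0,1]^d} F(Ψ, X_i, M_i)`. -/
noncomputable def campbell (Q : Measure (MarkedConfig d N)) :
    Measure (MarkedConfig d N × (EuclideanSpace ℝ (Fin d) × N)) :=
  (Q ⊗ₘ countingKernel d N).restrict {z | z.2.1 ∈ unitCube d}

lemma measurableSet_snd_fst_mem_unitCube : MeasurableSet
    {z : MarkedConfig d N × (EuclideanSpace ℝ (Fin d) × N) | z.2.1 ∈ unitCube d} :=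
  measurableSet_unitCube.preimage (by fun_prop)

lemma lintegral_campbell (Q : Measure (MarkedConfig d N)) [SFinite Q]
    {F : MarkedConfig d N × (EuclideanSpace ℝ (Fin d) × N) → ℝ≥0∞} (hF : Measurable F) :
    ∫⁻ z, F z ∂(campbell Q) =
      ∫⁻ ψ, ∫⁻ q, cubeInd d q.1 * F (ψ, q) ∂ψ.countingMeasure ∂Q := by
  rw [campbell, ← lintegral_indicator measurableSet_snd_fst_mem_unitCube,
    Measure.lintegral_compProd (hF.indicator measurableSet_snd_fst_mem_unitCube)]
  refine lintegral_congr fun ψ => lintegral_congr fun q => ?_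
  by_cases h : q.1 ∈ unitCube d <;> simp [cubeInd, h]

lemma ae_forall_atoms_of_ae_campbell {Q : Measure (MarkedConfig d N)} [SFinite Q]
    (hQ : Stationary Q) {A : Set (MarkedConfig d N × (EuclideanSpace ℝ (Fin d) × N))}
    (hA : MeasurableSet A) (hAT : ∀ y ψ q, (shift y ψ, shiftAtom y q) ∈ A ↔ (ψ, q) ∈ A)
    (h : ∀ᵐ z ∂(campbell Q), z ∈ A) : ∀ᵐ ψ ∂Q, ∀ q ∈ ψ.atoms, (ψ, q) ∈ A :=
  ae_forall_atoms hQ hA hAT ((ae_restrict_iff' measurableSet_snd_fst_mem_unitCube).1 h)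

/-- The unnormalised Palm measure `λ P⁰`, as a measure on all configurations. -/
noncomputable def palmTotal (P : Measure (MarkedConfig d M)) : Measure (MarkedConfig d M) :=
  (campbell P).map fun z => z.1.shift z.2.1

lemma lintegral_palmTotal (P : Measure (MarkedConfig d M)) [SFinite P]
    {F : MarkedConfig d M → ℝ≥0∞} (hF : Measurable F) :
    ∫⁻ φ, F φ ∂(palmTotal P) =
      ∫⁻ φ, ∫⁻ p, cubeInd d p.1 * F (φ.shift p.1) ∂φ.countingMeasure ∂P := by
  rw [palmTotal, lintegral_map hF (by fun_prop), lintegral_campbell P (by fun_prop)]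

/-- The unnormalised Palm measure of a marking, recording the projection and the extra mark. -/
noncomputable def markedPalm {M' : Type*} [MeasurableSpace M']
    (Q : Measure (MarkedConfig d (M × M'))) : Measure (MarkedConfig d M × M') :=
  (campbell Q).map fun z => (z.1.proj.shift z.2.1, z.2.2.2)

variable {M' : Type*} [MeasurableSpace M']

lemma lintegral_markedPalm (Q : Measure (MarkedConfig d (M × M'))) [SFinite Q]
    {F : MarkedConfig d M × M' → ℝ≥0∞} (hF : Measurable F) :
    ∫⁻ z, F z ∂(markedPalm Q) = ∫⁻ ψ, ∫⁻ q, cubeInd d q.1 *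
      F (ψ.proj.shift q.1, q.2.2) ∂ψ.countingMeasure ∂Q := by
  rw [markedPalm, lintegral_map hF (by fun_prop), lintegral_campbell Q (by fun_prop)]

/-- All stationary markings share this marginal, which makes their scores comparable point by point
in `φ`. -/
lemma markedPalm_map_fst {P : Measure (MarkedConfig d M)} [SFinite P]
    {Q : Measure (MarkedConfig d (M × M'))} [SFinite Q] (h : MeasurePreserving proj Q P) :
    (markedPalm Q).map Prod.fst = palmTotal P := by
  refine Measure.ext_of_lintegral _ fun F hF => ?_
  rw [lintegral_map hF measurable_fst, lintegral_markedPalm Q (by fun_prop),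
    lintegral_palmTotal P hF, ← h.lintegral_comp (measurable_lintegral_countingMeasure
      (F := fun φ p => cubeInd d p.1 * F (φ.shift p.1)) (by fun_prop))]
  refine lintegral_congr fun ψ => ?_
  rw [countingMeasure_proj, lintegral_map (by fun_prop) (by fun_prop)]

lemma markedPalm_map_markBy (P : Measure (MarkedConfig d M)) [SFinite P]
    {g : MarkedConfig d M → M'} (hg : Measurable g) :
    markedPalm (P.map fun φ => φ.markBy fun φ => g φ.1) =
      (palmTotal P).map fun φ => (φ, g φ) := by
  refine Measure.ext_of_lintegral _ fun F hF => ?_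
  rw [lintegral_map hF (by fun_prop), lintegral_markedPalm _ hF,
    lintegral_palmTotal P (by fun_prop),
    lintegral_map (measurable_lintegral_countingMeasure
      (F := fun ψ q => cubeInd d q.1 * F (ψ.proj.shift q.1, q.2.2)) (by fun_prop))
      (measurable_markBy hg)]
  refine lintegral_congr fun φ => ?_
  simp only [proj_markBy]
  rw [countingMeasure_markBy hg, lintegral_map (by fun_prop) (by fun_prop)]

lemma palm_map_val (P : Measure (MarkedConfig d M)) [SFinite P] :
    (palm P).map Subtype.val = (intensity P)⁻¹ • palmTotal P := by
  ext A hA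
  have h1 : Measurable (A.indicator (1 : MarkedConfig d M → ℝ≥0∞)) := measurable_one.indicator hA
  rw [Measure.map_apply measurable_subtype_coe hA, palm,
    Measure.ofMeasurable_apply _ (measurable_subtype_coe hA), Measure.smul_apply, smul_eq_mul,
    ← lintegral_indicator_one hA, lintegral_palmTotal P h1]
  congr 1
  refine lintegral_congr fun φ => ?_
  rw [← tsum_cubeAtoms φ (F := fun p => A.indicator 1 (φ.shift p.1))
    (by fun_prop)]
  rfl

/-- Finite intensity makes the normalising factor nonzero, so the null sets agree. The existential
on the right also records that `palmTotal P` charges only configurations with an atom at the origin.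
-/
lemma ae_palm_iff {P : Measure (MarkedConfig d M)} [SFinite P] (hfin : intensity P < ⊤)
    {p : PalmConfig d M → Prop} :
    (∀ᵐ φ ∂(palm P), p φ) ↔ ∀ᵐ φ ∂(palmTotal P), ∃ h, p ⟨φ, h⟩ := by
  have h1 := (MeasurableEmbedding.subtype_coe (measurableSet_palmConfig (d := d)
    (M := M))).ae_map_iff (μ := palm P) (p := fun φ => ∃ h, p ⟨φ, h⟩)
  rw [← Measure.ae_ennreal_smul_measure_iff (μ := palmTotal P)
    (ENNReal.inv_ne_zero.2 hfin.ne), ← palm_map_val]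
  refine Iff.trans ?_ h1.symm
  exact ⟨fun h => h.mono fun φ hφ => ⟨φ.2, hφ⟩, fun h => h.mono fun φ ⟨_, hφ⟩ => hφ⟩

/-- A property that holds for the Palm measure holds at all atoms almost surely. -/
lemma ae_forall_atoms_of_ae_palmTotal {P : Measure (MarkedConfig d M)} [SFinite P]
    (hP : Stationary P) {p : MarkedConfig d M → Prop} (h : ∀ᵐ φ ∂(palmTotal P), p φ) :
    ∀ᵐ φ ∂P, ∀ x ∈ φ.atoms, p (φ.shift x.1) := by
  obtain ⟨S, hSp, hS, hS0⟩ : ∃ S ⊆ {φ | p φ}, MeasurableSet S ∧ palmTotal P Sᶜ = 0 := by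
    obtain ⟨t, ht, htm, ht0⟩ := exists_measurable_superset_of_null (ae_iff.1 h)
    exact ⟨tᶜ, fun φ hφ => by by_contra h'; exact hφ (ht h'), htm.compl, by simpa using ht0⟩
  have hA : MeasurableSet {z : MarkedConfig d M × (EuclideanSpace ℝ (Fin d) × M) |
      z.1.shift z.2.1 ∈ S} := hS.preimage (by fun_prop)
  have h2 : ∀ᵐ z ∂(campbell P), z.1.shift z.2.1 ∈ S :=
    ae_of_ae_map (by fun_prop) (p := (· ∈ S)) (mem_ae_iff.2 hS0)
  refine (ae_forall_atoms_of_ae_campbell hP hA (fun y ψ q => ?_) h2).mono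
    fun φ hφ x hx => hSp (hφ x hx)
  simp [shiftAtom, shift_shift]

/-- The equation for the mark is shift invariant, so it passes from the atoms in the unit cube to
all atoms. -/
lemma ae_eq_markBy_of_ae_markedPalm {Q : Measure (MarkedConfig d (M × ℝ≥0))} [SFinite Q]
    (hQ : Stationary Q) {g : MarkedConfig d M → ℝ≥0} (hg : Measurable g)
    (h : ∀ᵐ z ∂(markedPalm Q), z.2 = g z.1) :
    ∀ᵐ ψ ∂Q, ψ = ψ.proj.markBy fun φ => g φ.1 := by
  have hA : MeasurableSet {z : MarkedConfig d (M × ℝ≥0) × (EuclideanSpace ℝ (Fin d) × (M × ℝ≥0)) |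
      z.2.2.2 = g (z.1.proj.shift z.2.1)} :=
    measurableSet_eq_fun (by fun_prop) (by fun_prop)
  have h2 : ∀ᵐ z ∂(campbell Q), z.2.2.2 = g (z.1.proj.shift z.2.1) :=
    ae_of_ae_map (p := fun z : MarkedConfig d M × ℝ≥0 => z.2 = g z.1) (by fun_prop) h
  refine (ae_forall_atoms_of_ae_campbell hQ hA (fun y ψ q => ?_) h2).mono fun ψ hψ => eq_markBy_proj fun q hq => hψ q hq
  simp [shiftAtom, proj_shift, shift_shift]

lemma markBy_mem_stationaryMarkings {P : Measure (MarkedConfig d M)} [IsProbabilityMeasure P]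
    (hP : Stationary P) {g : MarkedConfig d M → ℝ≥0} (hg : Measurable g) :
    P.map (fun φ => φ.markBy fun φ => g φ.1) ∈ stationaryMarkings P := by
  have hm := measurable_markBy hg
  refine ⟨Measure.isProbabilityMeasure_map hm.aemeasurable, fun y => ⟨measurable_shift_const y, ?_⟩,
    measurable_proj, ?_⟩
  · rw [Measure.map_map (measurable_shift_const y) hm]
    conv_rhs => rw [← (hP y).map_eq, Measure.map_map hm (measurable_shift_const y)]
    congr 1
    ext1 φ
    exact (markBy_shift g y φ).symm
  · rw [Measure.map_map measurable_proj hm]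
    convert Measure.map_id
    ext1 φ
    exact proj_markBy _ φ

/-- Such a marking is almost surely a function of its projection, whose law is `P`. -/
lemma eq_map_markBy_of_ae_markedPalm {P : Measure (MarkedConfig d M)}
    {Q : Measure (MarkedConfig d (M × ℝ≥0))} (hQ : Q ∈ stationaryMarkings P)
    {g : MarkedConfig d M → ℝ≥0} (hg : Measurable g)
    (h : ∀ᵐ z ∂(markedPalm Q), z.2 = g z.1) :
    Q = P.map (fun φ => φ.markBy fun φ => g φ.1) := by
  obtain ⟨_, hs, hp⟩ := hQ
  rw [← hp.map_eq, Measure.map_map (measurable_markBy hg) hp.measurable]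
  conv_lhs => rw [← Measure.map_id (μ := Q)]
  exact Measure.map_congr (ae_eq_markBy_of_ae_markedPalm hs hg h)

end Palm

/-! ### Additive scores and the mass transport formula. -/

section Scores

open MarkedConfig

variable {d : ℕ} {M : Type*} [MeasurableSpace M]

@[fun_prop]
lemma Measurable.lintegral_countingMeasure {α N : Type*} [MeasurableSpace α] [MeasurableSpace N]
    {φ : α → MarkedConfig d N} (hφ : Measurable φ)
    {F : α → EuclideanSpace ℝ (Fin d) × N → ℝ≥0∞} (hF : Measurable (Function.uncurry F)) :
    Measurable fun a => ∫⁻ q, F a q ∂(φ a).countingMeasure :=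
  Measurable.lintegral_kernel_prod_right (κ := (countingKernel d N).comap φ hφ) hF

/-- The total contribution `∑_i k(X_i, M'_i, S_{X_i} Φ)` received by the origin. -/
noncomputable def received (k : EuclideanSpace ℝ (Fin d) → ℝ≥0 → MarkedConfig d M → ℝ≥0∞)
    (ψ : MarkedConfig d (M × ℝ≥0)) : ℝ≥0∞ :=
  ∫⁻ r, k r.1 r.2.2 (ψ.proj.shift r.1) ∂ψ.countingMeasure

/-- The total contribution `∑_{x ∈ φ} k(-x, m, φ)` sent from the origin. -/
noncomputable def sent (k : EuclideanSpace ℝ (Fin d) → ℝ≥0 → MarkedConfig d M → ℝ≥0∞)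
    (m : ℝ≥0) (φ : MarkedConfig d M) : ℝ≥0∞ :=
  ∫⁻ p, k (-p.1) m φ ∂φ.countingMeasure

variable {k : EuclideanSpace ℝ (Fin d) → ℝ≥0 → MarkedConfig d M → ℝ≥0∞}

lemma measurable_kernel_comp
    (hk : Measurable fun a : EuclideanSpace ℝ (Fin d) × ℝ≥0 × MarkedConfig d M => k a.1 a.2.1 a.2.2)
    {α : Type*} [MeasurableSpace α] {x : α → EuclideanSpace ℝ (Fin d)} {m : α → ℝ≥0}
    {φ : α → MarkedConfig d M} (hx : Measurable x) (hm : Measurable m) (hφ : Measurable φ) :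
    Measurable fun a => k (x a) (m a) (φ a) :=
  hk.comp (hx.prodMk (hm.prodMk hφ))

lemma measurable_received
    (hk : Measurable fun a : EuclideanSpace ℝ (Fin d) × ℝ≥0 × MarkedConfig d M =>
      k a.1 a.2.1 a.2.2) : Measurable (received k) :=
  Measurable.lintegral_countingMeasure measurable_id
    (measurable_kernel_comp hk (by fun_prop) (by fun_prop) (by fun_prop))

lemma measurable_sent
    (hk : Measurable fun a : EuclideanSpace ℝ (Fin d) × ℝ≥0 × MarkedConfig d M =>
      k a.1 a.2.1 a.2.2) : Measurable fun z : MarkedConfig d M × ℝ≥0 => sent k z.2 z.1 :=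
  Measurable.lintegral_countingMeasure measurable_fst
    (measurable_kernel_comp hk (by fun_prop) (by fun_prop) (by fun_prop))

lemma received_shift
    (hk : Measurable fun a : EuclideanSpace ℝ (Fin d) × ℝ≥0 × MarkedConfig d M => k a.1 a.2.1 a.2.2)
    (y : EuclideanSpace ℝ (Fin d)) (ψ : MarkedConfig d (M × ℝ≥0)) :
    received k (ψ.shift y) = ∫⁻ r, k (r.1 - y) r.2.2 (ψ.proj.shift r.1) ∂ψ.countingMeasure := by
  rw [received, countingMeasure_shift, lintegral_map
    (measurable_kernel_comp hk (by fun_prop) (by fun_prop) (by fun_prop)) (by fun_prop)]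
  simp [proj_shift, shift_shift]

lemma sent_shift
    (hk : Measurable fun a : EuclideanSpace ℝ (Fin d) × ℝ≥0 × MarkedConfig d M => k a.1 a.2.1 a.2.2)
    (m : ℝ≥0) (y : EuclideanSpace ℝ (Fin d)) (ψ : MarkedConfig d (M × ℝ≥0)) :
    sent k m (ψ.proj.shift y) = ∫⁻ q, k (y - q.1) m (ψ.proj.shift y) ∂ψ.countingMeasure := by
  rw [sent, countingMeasure_shift, countingMeasure_proj, Measure.map_map (by fun_prop)
    (by fun_prop), lintegral_map
    (measurable_kernel_comp hk (by fun_prop) (by fun_prop) (by fun_prop)) (by fun_prop)]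
  simp

instance (ψ : MarkedConfig d M) : SFinite ψ.countingMeasure :=
  inferInstanceAs (SFinite (countingKernel d M ψ))

/-- The mass transport principle: in a stationary marking, the expected contribution received by
the points in the unit cube equals the expected contribution sent by them. -/
theorem lintegral_received_eq_lintegral_sent
    (hk : Measurable fun a : EuclideanSpace ℝ (Fin d) × ℝ≥0 × MarkedConfig d M => k a.1 a.2.1 a.2.2)
    {Q : Measure (MarkedConfig d (M × ℝ≥0))} [SFinite Q] (hQ : Stationary Q) :
    ∫⁻ ψ, ∫⁻ q, cubeInd d q.1 * received k (ψ.shift q.1) ∂ψ.countingMeasure ∂Q =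
      ∫⁻ z, sent k z.2 z.1 ∂(markedPalm Q) := by
  -- For a pair `(q, r)` of atoms, `G` is what `q` receives from `r`. Exchanging base points moves
  -- the cube restriction from the receiver `q` to the sender `r`.
  let G : MarkedConfig d (M × ℝ≥0) × ((EuclideanSpace ℝ (Fin d) × (M × ℝ≥0)) ×
    (EuclideanSpace ℝ (Fin d) × (M × ℝ≥0))) → ℝ≥0∞ := fun z =>
      k (z.2.2.1 - z.2.1.1) z.2.2.2.2 (z.1.proj.shift z.2.2.1)
  have hG : Measurable G := measurable_kernel_comp hk (by fun_prop) (by fun_prop) (by fun_prop)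
  have h := hQ.lintegral_unitCube_exchange
    (ν := countingKernel d (M × ℝ≥0) ×ₖ countingKernel d (M × ℝ≥0))
    (T := fun y => Prod.map (shiftAtom y) (shiftAtom y))
    (fun y => (measurable_shiftAtom y).prodMap (measurable_shiftAtom y))
    (fun y ψ => by
      rw [Kernel.prod_apply, Kernel.prod_apply, countingKernel_apply, countingKernel_apply,
        countingMeasure_shift]
      exact Measure.map_prod_map _ _ (measurable_shiftAtom y) (measurable_shiftAtom y))
    (a := fun z => z.1.1) (b := fun z => z.2.1) (by fun_prop) (by fun_prop)
    (fun y z => rfl) (fun y z => rfl) hG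
    (fun y ψ z => by simp [G, shiftAtom, proj_shift, shift_shift])
  rw [Measure.lintegral_compProd (by fun_prop), Measure.lintegral_compProd (by fun_prop)] at h
  simp only [Kernel.prod_apply, countingKernel_apply] at h
  rw [lintegral_markedPalm Q (measurable_sent hk)]
  refine (lintegral_congr fun ψ => ?_).trans (h.trans (lintegral_congr fun ψ => ?_))
  · rw [lintegral_prod _ (by fun_prop)]
    refine lintegral_congr fun q => ?_
    rw [received_shift hk]
    exact (lintegral_const_mul _ (hG.comp (by fun_prop : Measurable fun r => (ψ, q, r)))).symm
  · rw [lintegral_prod_symm _ (by fun_prop)]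
    refine lintegral_congr fun r => ?_
    rw [sent_shift hk]
    exact lintegral_const_mul (cubeInd d r.1)
      (hG.comp (by fun_prop : Measurable fun q => (ψ, q, r)))

open Classical in
/-- The extension of a score by `0` to configurations without a point at the origin. -/
noncomputable def extendScore (H : EuclideanSpace ℝ (Fin d) → ℝ≥0 → PalmConfig d M → EReal)
    (x : EuclideanSpace ℝ (Fin d)) (m : ℝ≥0) (φ : MarkedConfig d M) : EReal :=
  if h : ∃ m, (0, m) ∈ φ.atoms then H x m ⟨φ, h⟩ else 0

variable {H : EuclideanSpace ℝ (Fin d) → ℝ≥0 → PalmConfig d M → EReal}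

omit [MeasurableSpace M] in
lemma extendScore_val (x : EuclideanSpace ℝ (Fin d)) (m : ℝ≥0) (φ : PalmConfig d M) :
    extendScore H x m φ.1 = H x m φ := dif_pos φ.2

lemma measurable_extendScore
    (hH : Measurable fun a : EuclideanSpace ℝ (Fin d) × ℝ≥0 × PalmConfig d M => H a.1 a.2.1 a.2.2) :
    Measurable fun a : EuclideanSpace ℝ (Fin d) × ℝ≥0 × MarkedConfig d M =>
      extendScore H a.1 a.2.1 a.2.2 := by
  classical
  have hs : MeasurableSet {a : EuclideanSpace ℝ (Fin d) × ℝ≥0 × MarkedConfig d M |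
      ∃ m, (0, m) ∈ a.2.2.atoms} :=
    measurableSet_palmConfig.preimage (f := fun a : EuclideanSpace ℝ (Fin d) × ℝ≥0 ×
      MarkedConfig d M => a.2.2) (by fun_prop)
  have hm1 : Measurable fun a : {a : EuclideanSpace ℝ (Fin d) × ℝ≥0 × MarkedConfig d M |
      ∃ m, (0, m) ∈ a.2.2.atoms} => a.1.1 := by fun_prop
  have hm2 : Measurable fun a : {a : EuclideanSpace ℝ (Fin d) × ℝ≥0 × MarkedConfig d M |
      ∃ m, (0, m) ∈ a.2.2.atoms} => a.1.2.1 := by fun_prop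
  have hm3 : Measurable fun a : {a : EuclideanSpace ℝ (Fin d) × ℝ≥0 × MarkedConfig d M |
      ∃ m, (0, m) ∈ a.2.2.atoms} => a.1.2.2 := by fun_prop
  exact Measurable.dite
    (f := fun a => H a.1.1 a.1.2.1 ⟨a.1.2.2, a.2⟩) (g := fun _ => 0)
    (hH.comp (g := fun a : EuclideanSpace ℝ (Fin d) × ℝ≥0 × PalmConfig d M => H a.1 a.2.1 a.2.2)
      (hm1.prodMk (hm2.prodMk (Measurable.subtype_mk hm3)))) measurable_const hs

/-- The positive part of a score. -/
noncomputable def posScore (H : EuclideanSpace ℝ (Fin d) → ℝ≥0 → PalmConfig d M → EReal)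
    (x : EuclideanSpace ℝ (Fin d)) (m : ℝ≥0) (φ : MarkedConfig d M) : ℝ≥0∞ :=
  (extendScore H x m φ).toENNReal

/-- The negative part of a score. -/
noncomputable def negScore (H : EuclideanSpace ℝ (Fin d) → ℝ≥0 → PalmConfig d M → EReal)
    (x : EuclideanSpace ℝ (Fin d)) (m : ℝ≥0) (φ : MarkedConfig d M) : ℝ≥0∞ :=
  (-extendScore H x m φ).toENNReal

lemma measurable_posScore
    (hH : Measurable fun a : EuclideanSpace ℝ (Fin d) × ℝ≥0 × PalmConfig d M => H a.1 a.2.1 a.2.2) :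
    Measurable fun a : EuclideanSpace ℝ (Fin d) × ℝ≥0 × MarkedConfig d M =>
      posScore H a.1 a.2.1 a.2.2 :=
  (measurable_extendScore hH).ereal_toENNReal

lemma measurable_negScore
    (hH : Measurable fun a : EuclideanSpace ℝ (Fin d) × ℝ≥0 × PalmConfig d M => H a.1 a.2.1 a.2.2) :
    Measurable fun a : EuclideanSpace ℝ (Fin d) × ℝ≥0 × MarkedConfig d M =>
      negScore H a.1 a.2.1 a.2.2 :=
  (measurable_extendScore hH).neg.ereal_toENNReal

lemma additiveScore_eq
    (hH : Measurable fun a : EuclideanSpace ℝ (Fin d) × ℝ≥0 × PalmConfig d M => H a.1 a.2.1 a.2.2)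
    (ψ : PalmConfig d (M × ℝ≥0)) :
    additiveScore H ψ = (received (posScore H) ψ.1 : EReal) - (received (negScore H) ψ.1 : EReal) := by
  rw [received, received, lintegral_countingMeasure _
      (measurable_kernel_comp (measurable_posScore hH) (by fun_prop) (by fun_prop) (by fun_prop)),
    lintegral_countingMeasure _
      (measurable_kernel_comp (measurable_negScore hH) (by fun_prop) (by fun_prop) (by fun_prop))]
  simp only [additiveScore, esum, ← extendScore_val, posScore, negScore]
  rfl

/-- `f(m, φ)` for an arbitrary configuration `φ`. -/
noncomputable def totalScore (H : EuclideanSpace ℝ (Fin d) → ℝ≥0 → PalmConfig d M → EReal)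
    (m : ℝ≥0) (φ : MarkedConfig d M) : EReal :=
  (sent (posScore H) m φ : EReal) - (sent (negScore H) m φ : EReal)

lemma measurable_totalScore
    (hH : Measurable fun a : EuclideanSpace ℝ (Fin d) × ℝ≥0 × PalmConfig d M => H a.1 a.2.1 a.2.2) :
    Measurable fun z : MarkedConfig d M × ℝ≥0 => totalScore H z.2 z.1 :=
  (measurable_sent (measurable_posScore hH)).coe_ereal_ennreal.sub
    (measurable_sent (measurable_negScore hH)).coe_ereal_ennreal

lemma measurable_totalScore_comp
    (hH : Measurable fun a : EuclideanSpace ℝ (Fin d) × ℝ≥0 × PalmConfig d M => H a.1 a.2.1 a.2.2)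
    {α : Type*} [MeasurableSpace α] {m : α → ℝ≥0} {φ : α → MarkedConfig d M} (hm : Measurable m)
    (hφ : Measurable φ) : Measurable fun a => totalScore H (m a) (φ a) :=
  (measurable_totalScore hH).comp (f := fun a => (φ a, m a)) (hφ.prodMk hm)

lemma transportedScore_eq
    (hH : Measurable fun a : EuclideanSpace ℝ (Fin d) × ℝ≥0 × PalmConfig d M => H a.1 a.2.1 a.2.2)
    (m : ℝ≥0) (φ : PalmConfig d M) : transportedScore H m φ = totalScore H m φ.1 := by
  rw [totalScore, sent, sent, lintegral_countingMeasure _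
      (measurable_kernel_comp (measurable_posScore hH) (by fun_prop) (by fun_prop) (by fun_prop)),
    lintegral_countingMeasure _
      (measurable_kernel_comp (measurable_negScore hH) (by fun_prop) (by fun_prop) (by fun_prop))]
  simp only [transportedScore, esum, ← extendScore_val, posScore, negScore]

/-- A score is admissible if its values are all in `[0, ∞) ∪ {-∞}` or all in `[-∞, 0]`. -/
def AdmissibleScore (H : EuclideanSpace ℝ (Fin d) → ℝ≥0 → PalmConfig d M → EReal) : Prop :=
  (∀ x m φ, H x m φ = ⊥ ∨ (0 ≤ H x m φ ∧ H x m φ < ⊤)) ∨ (∀ x m φ, H x m φ ≤ 0)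

omit [MeasurableSpace M] in
-- This dichotomy is the hypothesis of `eexpect_sub`. It survives summation over atoms, so positive
-- and negative parts can be transported separately.
lemma AdmissibleScore.extendScore (h : AdmissibleScore H) :
    (∀ x m φ, negScore H x m φ = 0 ∨ negScore H x m φ = ⊤) ∨ ∀ x m φ, posScore H x m φ = 0 := by
  refine h.imp (fun h x m φ => ?_) (fun h x m φ => ?_)
  · by_cases hφ : ∃ m, (0, m) ∈ φ.atoms
    · rw [negScore, extendScore_val (φ := ⟨φ, hφ⟩)]
      rcases h x m ⟨φ, hφ⟩ with h | ⟨h, -⟩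
      · right; simp [h]
      · left; exact EReal.toENNReal_of_nonpos (by simpa using h)
    · left; simp [negScore, _root_.extendScore, hφ]
  · by_cases hφ : ∃ m, (0, m) ∈ φ.atoms
    · rw [posScore, extendScore_val (φ := ⟨φ, hφ⟩)]
      exact EReal.toENNReal_of_nonpos (h x m ⟨φ, hφ⟩)
    · simp [posScore, _root_.extendScore, hφ]

lemma AdmissibleScore.sent (h : AdmissibleScore H)
    (hH : Measurable fun a : EuclideanSpace ℝ (Fin d) × ℝ≥0 × PalmConfig d M => H a.1 a.2.1 a.2.2) :
    (∀ z : MarkedConfig d M × ℝ≥0, _root_.sent (negScore H) z.2 z.1 = 0 ∨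
      _root_.sent (negScore H) z.2 z.1 = ⊤) ∨
    ∀ z : MarkedConfig d M × ℝ≥0, _root_.sent (posScore H) z.2 z.1 = 0 := by
  refine h.extendScore.imp (fun h z => ?_) (fun h z => by simp [_root_.sent, h])
  rw [_root_.sent, lintegral_countingMeasure _
    (measurable_kernel_comp (measurable_negScore hH) (by fun_prop) (by fun_prop) (by fun_prop))]
  exact ENNReal.tsum_eq_zero_or_top fun i => h _ _ _

lemma AdmissibleScore.received (h : AdmissibleScore H)
    (hH : Measurable fun a : EuclideanSpace ℝ (Fin d) × ℝ≥0 × PalmConfig d M => H a.1 a.2.1 a.2.2) :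
    (∀ ψ, _root_.received (negScore H) ψ = 0 ∨ _root_.received (negScore H) ψ = ⊤) ∨
    ∀ ψ, _root_.received (posScore H) ψ = 0 := by
  refine h.extendScore.imp (fun h ψ => ?_) (fun h ψ => by simp [_root_.received, h])
  rw [_root_.received, lintegral_countingMeasure _
    (measurable_kernel_comp (measurable_negScore hH) (by fun_prop) (by fun_prop) (by fun_prop))]
  exact ENNReal.tsum_eq_zero_or_top fun i => h _ _ _

/-- The intensity of an additive score is the expectation of `f` under the Palm measure. -/
theorem scoreIntensity_additiveScore
    (hH : Measurable fun a : EuclideanSpace ℝ (Fin d) × ℝ≥0 × PalmConfig d M => H a.1 a.2.1 a.2.2)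
    (h : AdmissibleScore H) {Q : Measure (MarkedConfig d (M × ℝ≥0))} [SFinite Q]
    (hQ : Stationary Q) :
    scoreIntensity (additiveScore H) Q =
      eexpect (markedPalm Q) fun z => totalScore H z.2 z.1 := by
  have hp := measurable_posScore hH
  have hn := measurable_negScore hH
  have hrp := measurable_received hp
  have hrn := measurable_received hn
  have h1 : ∀ ψ : MarkedConfig d (M × ℝ≥0),
      esum (fun q : ψ.cubeAtoms => additiveScore H (ψ.recenter q.1)) =
      ((∑' q : ψ.cubeAtoms, received (posScore H) (ψ.shift q.1.1.1) : ℝ≥0∞) : EReal) -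
      ((∑' q : ψ.cubeAtoms, received (negScore H) (ψ.shift q.1.1.1) : ℝ≥0∞) : EReal) := fun ψ => by
    simp only [additiveScore_eq hH]
    exact esum_sub ((h.received hH).imp (fun h i => h _) (fun h i => h _))
  simp only [scoreIntensity, h1]
  have h2 : ∀ k : EuclideanSpace ℝ (Fin d) → ℝ≥0 → MarkedConfig d M → ℝ≥0∞,
      Measurable (received k) → ∀ ψ : MarkedConfig d (M × ℝ≥0),
      ∑' q : ψ.cubeAtoms, received k (ψ.shift q.1.1.1) =
      ∫⁻ q, cubeInd d q.1 * received k (ψ.shift q.1) ∂ψ.countingMeasure := fun k hk ψ =>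
    tsum_cubeAtoms ψ (F := fun q => received k (ψ.shift q.1)) (by fun_prop)
  rw [eexpect_sub]
  · simp only [h2 _ hrp, h2 _ hrn]
    rw [lintegral_received_eq_lintegral_sent hp hQ, lintegral_received_eq_lintegral_sent hn hQ]
    exact (eexpect_sub (measurable_sent hn) (h.sent hH)).symm
  · simp only [h2 _ hrn]
    exact Measurable.lintegral_countingMeasure measurable_id
      (F := fun ψ q => cubeInd d q.1 * received (negScore H) (ψ.shift q.1)) (by fun_prop)
  · exact (h.received hH).imp (fun h ψ => ENNReal.tsum_eq_zero_or_top fun i => h _)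
      (fun h ψ => by simp [h])

end Scores

/-! ### Measurable selection of the smallest maximizer. -/

section Selection

open TopologicalSpace

variable {X : Type*}

/-- The event that the supremum of `f φ` over `[t, s]` is its global supremum. -/
def argmaxHits (f : X → ℝ≥0 → EReal) (t s : ℝ≥0) : Set X :=
  {φ | ⨆ k, f φ (denseSeq ℝ≥0 k) ≤ ⨆ k, f φ (max t (min s (denseSeq ℝ≥0 k)))}

open Classical in
/-- A measurable version of the smallest maximizer of `f φ` in `[t, ∞)`. -/
noncomputable def leastArgmaxFrom (f : X → ℝ≥0 → EReal) (t : ℝ≥0) (φ : X) : ℝ≥0 :=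
  (⨅ k, if t ≤ denseSeq ℝ≥0 k ∧ φ ∈ argmaxHits f t (denseSeq ℝ≥0 k) then
    (denseSeq ℝ≥0 k : ℝ≥0∞) else ⊤).toNNReal

lemma measurable_leastArgmaxFrom [MeasurableSpace X] {f : X → ℝ≥0 → EReal}
    (hf : Measurable fun z : X × ℝ≥0 => f z.1 z.2) (t : ℝ≥0) :
    Measurable (leastArgmaxFrom f t) := by
  classical
  have hfc : ∀ m, Measurable fun φ => f φ m := fun m => hf.comp measurable_prodMk_right
  have hs : ∀ s, MeasurableSet (argmaxHits f t s) := fun s =>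
    measurableSet_le (.iSup fun k => hfc _) (.iSup fun k => hfc _)
  refine Measurable.ennreal_toNNReal (.iInf fun k => Measurable.ite ?_ measurable_const
    measurable_const)
  exact (MeasurableSet.const _).inter (hs _)

lemma le_of_forall_denseSeq_le {F : ℝ≥0 → EReal} (hF : Continuous F) {c : EReal}
    (h : ∀ k, F (denseSeq ℝ≥0 k) ≤ c) (m : ℝ≥0) : F m ≤ c :=
  isClosed_property (denseRange_denseSeq ℝ≥0) (isClosed_le hF continuous_const) h m

/-- Clamping to `[t, s]` turns the dense sequence into a dense subset of that interval, where
compactness yields a maximum; only countably many evaluations of `f` are involved. -/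
lemma mem_argmaxHits_iff {f : X → ℝ≥0 → EReal} {φ : X} (hφ : Continuous (f φ)) {t s : ℝ≥0}
    (hts : t ≤ s) : φ ∈ argmaxHits f t s ↔ ∃ m ∈ Set.Icc t s, ∀ m', f φ m' ≤ f φ m := by
  constructor
  · intro h
    obtain ⟨m, hm, hmax⟩ := (isCompact_Icc (a := t) (b := s)).exists_isMaxOn ⟨t, le_rfl, hts⟩
      hφ.continuousOn
    refine ⟨m, hm, le_of_forall_denseSeq_le hφ fun k => ?_⟩
    refine ((le_iSup (fun k => f φ (denseSeq ℝ≥0 k)) k).trans h).trans (iSup_le fun k => ?_)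
    exact hmax ⟨le_max_left _ _, max_le hts (min_le_left _ _)⟩
  · rintro ⟨m, hm, hmax⟩
    have hc : Continuous fun x => f φ (max t (min s x)) := hφ.comp (by fun_prop)
    have h1 := le_of_forall_denseSeq_le hc
      (le_iSup fun k => f φ (max t (min s (denseSeq ℝ≥0 k)))) m
    rw [min_eq_right hm.2, max_eq_right hm.1] at h1
    exact (iSup_le fun k => hmax _).trans h1

lemma isClosed_argmax_ge {F : ℝ≥0 → EReal} (hF : Continuous F) (t : ℝ≥0) :
    IsClosed {m | t ≤ m ∧ ∀ m', F m' ≤ F m} := by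
  have h : {m | t ≤ m ∧ ∀ m', F m' ≤ F m} = {m | t ≤ m} ∩ ⋂ m', {m | F m' ≤ F m} := by
    ext; simp
  rw [h]
  exact (isClosed_le continuous_const continuous_id).inter
    (isClosed_iInter fun m' => isClosed_le continuous_const hF)

lemma leastArgmaxFrom_eq {f : X → ℝ≥0 → EReal} {φ : X} (hφ : Continuous (f φ)) (t : ℝ≥0) :
    leastArgmaxFrom f t φ = sInf {m | t ≤ m ∧ ∀ m', f φ m' ≤ f φ m} := by
  classical
  set A := {m | t ≤ m ∧ ∀ m', f φ m' ≤ f φ m} with hA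
  have hit : ∀ s, t ≤ s ∧ φ ∈ argmaxHits f t s → ∃ m ∈ A, m ≤ s := fun s hs => by
    obtain ⟨m, hm, hmax⟩ := (mem_argmaxHits_iff hφ hs.1).1 hs.2
    exact ⟨m, ⟨hm.1, hmax⟩, hm.2⟩
  rw [leastArgmaxFrom]
  rcases A.eq_empty_or_nonempty with h | h
  -- Without a maximizer, `⊤.toNNReal` and `sInf ∅` are both `0`.
  · have : ∀ k, ¬ (t ≤ denseSeq ℝ≥0 k ∧ φ ∈ argmaxHits f t (denseSeq ℝ≥0 k)) := fun k hk => by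
      obtain ⟨m, hm, -⟩ := hit _ hk
      simp [h] at hm
    simp [this, h]
  · have hmem : sInf A ∈ A := (isClosed_argmax_ge hφ t).csInf_mem h (OrderBot.bddBelow _)
    rw [← ENNReal.toNNReal_coe (sInf A)]
    congr 1
    refine le_antisymm (le_of_forall_gt fun c hc => ?_) (le_iInf fun k => ?_)
    · obtain ⟨r, h1, h2⟩ := ENNReal.lt_iff_exists_nnreal_btwn.1 hc
      obtain ⟨k, hk1, hk2⟩ := (denseRange_denseSeq ℝ≥0).exists_mem_open
        (isOpen_Ioo (a := sInf A) (b := r)) (Set.nonempty_Ioo.2 (by exact_mod_cast h1))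
      refine (iInf_le _ k).trans_lt ?_
      have hle : t ≤ denseSeq ℝ≥0 k := hmem.1.trans hk1.le
      rw [if_pos ⟨hle, (mem_argmaxHits_iff hφ hle).2 ⟨_, ⟨hmem.1, hk1.le⟩, hmem.2⟩⟩]
      exact lt_trans (by exact_mod_cast hk2) h2
    · split_ifs with hk
      · obtain ⟨m, hm, hmk⟩ := hit _ hk
        exact_mod_cast (csInf_le (OrderBot.bddBelow _) hm).trans hmk
      · exact le_top

lemma leastArgmaxFrom_mem {f : X → ℝ≥0 → EReal} {φ : X} (hφ : Continuous (f φ)) {t m : ℝ≥0}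
    (htm : t ≤ m) (hm : ∀ m', f φ m' ≤ f φ m) :
    t ≤ leastArgmaxFrom f t φ ∧ ∀ m', f φ m' ≤ f φ (leastArgmaxFrom f t φ) := by
  rw [leastArgmaxFrom_eq hφ]
  exact (isClosed_argmax_ge hφ t).csInf_mem ⟨m, htm, hm⟩ (OrderBot.bddBelow _)

end Selection

/-! ### Optimality as pointwise maximisation under the Palm measure. -/

section Optimality

open MarkedConfig TopologicalSpace

variable {d : ℕ} {M : Type*} [MeasurableSpace M]
  {H : EuclideanSpace ℝ (Fin d) → ℝ≥0 → PalmConfig d M → EReal}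
  {P : Measure (MarkedConfig d M)} [IsProbabilityMeasure P]

/-- The law of the marking of `Φ` by `g (S_x Φ)`. -/
noncomputable def markingLaw (P : Measure (MarkedConfig d M)) (g : MarkedConfig d M → ℝ≥0) :
    Measure (MarkedConfig d (M × ℝ≥0)) :=
  P.map fun φ => φ.markBy fun φ => g φ.1

lemma scoreIntensity_markingLaw (hP : Stationary P)
    (hH : Measurable fun a : EuclideanSpace ℝ (Fin d) × ℝ≥0 × PalmConfig d M => H a.1 a.2.1 a.2.2)
    (h : AdmissibleScore H) {g : MarkedConfig d M → ℝ≥0} (hg : Measurable g) :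
    scoreIntensity (additiveScore H) (markingLaw P g) =
      eexpect (palmTotal P) fun φ => totalScore H (g φ) φ := by
  have hmem := markBy_mem_stationaryMarkings hP hg
  have := hmem.1
  rw [markingLaw, scoreIntensity_additiveScore hH h hmem.2.1, markedPalm_map_markBy P hg,
    eexpect_map (by fun_prop) (measurable_totalScore hH)]

omit [IsProbabilityMeasure P] in
lemma scoreIntensity_le_optIntensity {ξ : PalmConfig d (M × ℝ≥0) → EReal}
    {Q : Measure (MarkedConfig d (M × ℝ≥0))} (hQ : Q ∈ stationaryMarkings P) :
    scoreIntensity ξ Q ≤ optIntensity ξ P :=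
  le_iSup₂ (f := fun Q (_ : Q ∈ stationaryMarkings P) => scoreIntensity ξ Q) Q hQ

/-- The better of `g` and `g'` at each `φ` is again an admissible marking rule `b`. It cannot beat
the finite optimum, so its score agrees almost everywhere with that of `g`. -/
lemma totalScore_le_of_isIntensityOptimal (hP : Stationary P)
    (hH : Measurable fun a : EuclideanSpace ℝ (Fin d) × ℝ≥0 × PalmConfig d M => H a.1 a.2.1 a.2.2)
    (h : AdmissibleScore H) (hbot : optIntensity (additiveScore H) P ≠ ⊥)
    (htop : optIntensity (additiveScore H) P ≠ ⊤)
    {g g' : MarkedConfig d M → ℝ≥0} (hg : Measurable g) (hg' : Measurable g')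
    (hopt : IsIntensityOptimal (additiveScore H) P (markingLaw P g)) :
    ∀ᵐ φ ∂(palmTotal P), totalScore H (g' φ) φ ≤ totalScore H (g φ) φ := by
  classical
  have hfg : ∀ {g : MarkedConfig d M → ℝ≥0}, Measurable g →
      Measurable fun φ => totalScore H (g φ) φ := fun hg =>
    measurable_totalScore_comp hH hg measurable_id
  let b : MarkedConfig d M → ℝ≥0 := fun φ =>
    if totalScore H (g φ) φ < totalScore H (g' φ) φ then g' φ else g φ
  have hb : Measurable b := Measurable.ite (measurableSet_lt (hfg hg) (hfg hg')) hg' hg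
  have hle : ∀ φ, totalScore H (g φ) φ ≤ totalScore H (b φ) φ ∧
      totalScore H (g' φ) φ ≤ totalScore H (b φ) φ := fun φ => by
    by_cases hφ : totalScore H (g φ) φ < totalScore H (g' φ) φ
    · simp [b, hφ, hφ.le]
    · simp [b, hφ, not_lt.1 hφ]
  have heq : eexpect (palmTotal P) (fun φ => totalScore H (g φ) φ) =
      optIntensity (additiveScore H) P := by
    rw [← scoreIntensity_markingLaw hP hH h hg, hopt.2]
  have hle' : eexpect (palmTotal P) (fun φ => totalScore H (b φ) φ) ≤
      optIntensity (additiveScore H) P := by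
    rw [← scoreIntensity_markingLaw hP hH h hb]
    exact scoreIntensity_le_optIntensity (markBy_mem_stationaryMarkings hP hb)
  have hae := ae_eq_of_eexpect_eq (hfg hg) (hfg hb) (ae_of_all _ fun φ => (hle φ).1)
    (le_antisymm (eexpect_mono (ae_of_all _ fun φ => (hle φ).1)) (hle'.trans heq.ge))
    (heq ▸ hbot) (heq ▸ htop)
  filter_upwards [hae] with φ hφ
  exact (hle φ).2.trans hφ.ge

/-- The Palm measure of a marking by `g` lives on the graph of `g`. -/
lemma ae_eq_of_markingLaw_eq {g g' : MarkedConfig d M → ℝ≥0} (hg : Measurable g)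
    (hg' : Measurable g') (h : markingLaw P g' = markingLaw P g) : g' =ᵐ[palmTotal P] g := by
  have h1 : (palmTotal P).map (fun φ => (φ, g' φ)) = (palmTotal P).map (fun φ => (φ, g φ)) := by
    rw [← markedPalm_map_markBy P hg, ← markedPalm_map_markBy P hg']
    exact congrArg markedPalm h
  have hA : MeasurableSet {z : MarkedConfig d M × ℝ≥0 | z.2 = g z.1} :=
    measurableSet_eq_fun (by fun_prop) (by fun_prop)
  have h2 : ∀ᵐ z ∂((palmTotal P).map (fun φ => (φ, g φ))), z.2 = g z.1 :=
    (ae_map_iff (by fun_prop) hA).2 (ae_of_all _ fun φ => rfl)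
  rw [← h1] at h2
  exact (ae_map_iff (by fun_prop) hA).1 h2

/-- Continuity is known only Palm-a.s., so `argmaxMark` is merely almost surely equal to a
measurable selector at all atoms. This suffices for the laws, and shows that the `Measure.map` in
the definition does not take its default value `0`. -/
lemma argmaxMarkingLaw_eq (hP : Stationary P)
    (hH : Measurable fun a : EuclideanSpace ℝ (Fin d) × ℝ≥0 × PalmConfig d M => H a.1 a.2.1 a.2.2)
    (hcont : ∀ᵐ φ ∂(palmTotal P), ∃ h, Continuous fun m => transportedScore H m ⟨φ, h⟩) :
    argmaxMarkingLaw H P = markingLaw P (leastArgmaxFrom (fun φ m => totalScore H m φ) 0) := by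
  refine Measure.map_congr ?_
  have h1 : ∀ᵐ φ ∂(palmTotal P), ∀ h : ∃ m, (0, m) ∈ φ.atoms,
      argmaxMark H ⟨φ, h⟩ = leastArgmaxFrom (fun φ m => totalScore H m φ) 0 φ := by
    filter_upwards [hcont] with φ ⟨_, hφ⟩ h
    simp only [transportedScore_eq hH] at hφ
    rw [leastArgmaxFrom_eq hφ, argmaxMark, argmaxSet]
    simp [transportedScore_eq hH]
  filter_upwards [ae_forall_atoms_of_ae_palmTotal hP h1] with φ hφ
  have h2 : ∀ p : φ.atoms, argmaxMark H (φ.recenter p) =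
      leastArgmaxFrom (fun φ m => totalScore H m φ) 0 (φ.recenter p).1 := fun p =>
    hφ p.1 p.2 (φ.recenter p).2
  ext q
  simp only [markBy, h2]

/-- The pointwise bound holds at every mark, so it integrates against the Palm measure of any
competitor. -/
theorem isIntensityOptimal_of_ae_maximal (hP : Stationary P)
    (hH : Measurable fun a : EuclideanSpace ℝ (Fin d) × ℝ≥0 × PalmConfig d M => H a.1 a.2.1 a.2.2)
    (h : AdmissibleScore H) {g : MarkedConfig d M → ℝ≥0} (hg : Measurable g)
    (hmax : ∀ᵐ φ ∂(palmTotal P), ∀ m, totalScore H m φ ≤ totalScore H (g φ) φ) :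
    IsIntensityOptimal (additiveScore H) P (markingLaw P g) := by
  refine ⟨markBy_mem_stationaryMarkings hP hg, le_antisymm (scoreIntensity_le_optIntensity
    (markBy_mem_stationaryMarkings hP hg)) (iSup₂_le fun Q hQ => ?_)⟩
  have := hQ.1
  rw [scoreIntensity_markingLaw hP hH h hg, scoreIntensity_additiveScore hH h hQ.2.1,
    ← markedPalm_map_fst hQ.2.2, eexpect_map measurable_fst
      (X := fun φ => totalScore H (g φ) φ) (measurable_totalScore_comp hH hg measurable_id)]
  rw [← markedPalm_map_fst hQ.2.2] at hmax
  exact eexpect_mono ((ae_of_ae_map (by fun_prop) hmax).mono fun z hz => hz _)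

theorem ae_maximal_of_isIntensityOptimal (hP : Stationary P)
    (hH : Measurable fun a : EuclideanSpace ℝ (Fin d) × ℝ≥0 × PalmConfig d M => H a.1 a.2.1 a.2.2)
    (h : AdmissibleScore H) (hbot : optIntensity (additiveScore H) P ≠ ⊥)
    (htop : optIntensity (additiveScore H) P ≠ ⊤)
    {g : MarkedConfig d M → ℝ≥0} (hg : Measurable g)
    (hmax : ∀ᵐ φ ∂(palmTotal P), ∀ m, totalScore H m φ ≤ totalScore H (g φ) φ)
    {Q : Measure (MarkedConfig d (M × ℝ≥0))} (hQ : IsIntensityOptimal (additiveScore H) P Q) :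
    ∀ᵐ z ∂(markedPalm Q), ∀ m, totalScore H m z.1 ≤ totalScore H z.2 z.1 := by
  have := hQ.1.1
  have hf := measurable_totalScore hH
  have hfg : Measurable fun φ => totalScore H (g φ) φ :=
    measurable_totalScore_comp hH hg measurable_id
  have e1 : eexpect (markedPalm Q) (fun z => totalScore H z.2 z.1) =
      optIntensity (additiveScore H) P := by
    rw [← scoreIntensity_additiveScore hH h hQ.1.2.1, hQ.2]
  have e2 : eexpect (markedPalm Q) (fun z => totalScore H (g z.1) z.1) =
      optIntensity (additiveScore H) P := by
    rw [← eexpect_map (X := fun φ => totalScore H (g φ) φ) measurable_fst hfg,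
      markedPalm_map_fst hQ.1.2.2, ← scoreIntensity_markingLaw hP hH h hg,
      (isIntensityOptimal_of_ae_maximal hP hH h hg hmax).2]
  rw [← markedPalm_map_fst hQ.1.2.2] at hmax
  have hmax' := ae_of_ae_map (by fun_prop) hmax
  filter_upwards [hmax', ae_eq_of_eexpect_eq hf 
    (measurable_totalScore_comp hH (hg.comp measurable_fst) measurable_fst)
    (hmax'.mono fun z hz => hz _) (e1.trans e2.symm) (e1 ▸ hbot) (e1 ▸ htop)] with z hz he m
  exact (hz m).trans he.ge

end Optimality

/-! ### The equivalence. -/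

theorem mainTheorem7 {d : ℕ} {M : Type*} [TopologicalSpace M] [LocallyCompactSpace M]
    [SecondCountableTopology M] [T2Space M] [MeasurableSpace M] [BorelSpace M]
    (P : Measure (MarkedConfig d M)) [IsProbabilityMeasure P]
    (hstat : Stationary P) (hpos : 0 < intensity P) (hfin : intensity P < ⊤)
    (H : EuclideanSpace ℝ (Fin d) → ℝ≥0 → PalmConfig d M → EReal)
    (hmeas : Measurable fun a : EuclideanSpace ℝ (Fin d) × ℝ≥0 × PalmConfig d M =>
      H a.1 a.2.1 a.2.2)
    (hrange : (∀ x m φ, H x m φ = ⊥ ∨ (0 ≤ H x m φ ∧ H x m φ < ⊤)) ∨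
      (∀ x m φ, H x m φ ≤ 0))
    (hcont : ∀ᵐ φ ∂(palm P), Continuous fun m => transportedScore H m φ)
    (hopt_bot : ⊥ < optIntensity (additiveScore H) P)
    (hopt_top : optIntensity (additiveScore H) P < ⊤) :
    IsUniqueIntensityOptimal (additiveScore H) P (argmaxMarkingLaw H P) ↔
      ∀ᵐ φ ∂(palm P), ∃! m : ℝ≥0, ∀ m', transportedScore H m' φ ≤ transportedScore H m φ := by
  have hadm : AdmissibleScore H := hrange
  rw [ae_palm_iff hfin] at hcont ⊢
  rw [argmaxMarkingLaw_eq hstat hmeas hcont]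
  simp only [transportedScore_eq hmeas] at hcont ⊢
  have hf : Measurable fun z : MarkedConfig d M × ℝ≥0 => totalScore H z.2 z.1 :=
    measurable_totalScore hmeas
  set f : MarkedConfig d M → ℝ≥0 → EReal := fun φ m => totalScore H m φ with hfdef
  have hg : ∀ t, Measurable (leastArgmaxFrom f t) := measurable_leastArgmaxFrom hf
  constructor
  · rintro ⟨hopt, huniq⟩
    -- Existence of a maximizer is not assumed, and the selector could be the default `0`;
    -- comparison with constant marks excludes this.
    have hmax : ∀ᵐ φ ∂(palmTotal P), ∀ m, f φ m ≤ f φ (leastArgmaxFrom f 0 φ) := by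
      have h1 : ∀ᵐ φ ∂(palmTotal P), ∀ k, f φ (TopologicalSpace.denseSeq ℝ≥0 k) ≤
          f φ (leastArgmaxFrom f 0 φ) := ae_all_iff.2 fun k =>
        totalScore_le_of_isIntensityOptimal hstat hmeas hadm hopt_bot.ne' hopt_top.ne (hg 0)
          measurable_const hopt
      filter_upwards [h1, hcont] with φ hφ ⟨_, hc⟩
      exact le_of_forall_denseSeq_le hc hφ
    have hnext : ∀ t, ∀ᵐ φ ∂(palmTotal P), ∀ m, t ≤ m → (∀ m', f φ m' ≤ f φ m) →
        t ≤ leastArgmaxFrom f 0 φ := by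
      intro t
      classical
      -- Comparing scores avoids asking whether a maximizer in `[t, ∞)` exists. If the default `0`
      -- passes the test, it is a maximizer too.
      let g : MarkedConfig d M → ℝ≥0 := fun φ =>
        if f φ (leastArgmaxFrom f 0 φ) ≤ f φ (leastArgmaxFrom f t φ) then leastArgmaxFrom f t φ
        else leastArgmaxFrom f 0 φ
      have hgm : Measurable g := Measurable.ite
        (measurableSet_le (measurable_totalScore_comp hmeas (hg 0) measurable_id)
          (measurable_totalScore_comp hmeas (hg t) measurable_id)) (hg t) (hg 0)
      have hgmax : ∀ᵐ φ ∂(palmTotal P), ∀ m, f φ m ≤ f φ (g φ) := by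
        filter_upwards [hmax] with φ hφ m
        by_cases hle : f φ (leastArgmaxFrom f 0 φ) ≤ f φ (leastArgmaxFrom f t φ)
        · simpa only [g, if_pos hle] using (hφ m).trans hle
        · simpa only [g, if_neg hle] using hφ m
      filter_upwards [ae_eq_of_markingLaw_eq (hg 0) hgm
        (huniq _ (isIntensityOptimal_of_ae_maximal hstat hmeas hadm hgm hgmax)), hcont]
        with φ hφ ⟨_, hc⟩ m htm hm
      obtain ⟨h1, h2⟩ := leastArgmaxFrom_mem (f := f) hc htm hm
      simp only [g, if_pos (h2 _)] at hφ
      exact hφ ▸ h1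
    filter_upwards [hmax, hcont, ae_all_iff.2 fun k => hnext (TopologicalSpace.denseSeq ℝ≥0 k)]
      with φ hφ ⟨hp, hc⟩ hn
    refine ⟨hp, leastArgmaxFrom f 0 φ, hφ, fun m hm => ?_⟩
    have hle : leastArgmaxFrom f 0 φ ≤ m := by
      rw [leastArgmaxFrom_eq (f := f) hc]
      exact csInf_le (OrderBot.bddBelow _) ⟨zero_le, hm⟩
    by_contra hne
    -- A dense point `t` strictly between the smallest maximizer and a second one `m` contradicts
    -- `hnext t`.
    obtain ⟨k, hk1, hk2⟩ := (TopologicalSpace.denseRange_denseSeq ℝ≥0).exists_mem_open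
      isOpen_Ioo (Set.nonempty_Ioo.2 (lt_of_le_of_ne hle (Ne.symm hne)))
    exact (hn k m hk2.le hm).not_gt hk1
  · intro hex
    have hmax : ∀ᵐ φ ∂(palmTotal P), ∀ m, f φ m ≤ f φ (leastArgmaxFrom f 0 φ) := by
      filter_upwards [hex, hcont] with φ ⟨_, m, hm, _⟩ ⟨_, hc⟩
      exact (leastArgmaxFrom_mem (f := f) hc (zero_le) hm).2
    refine ⟨isIntensityOptimal_of_ae_maximal hstat hmeas hadm (hg 0) hmax, fun Q hQ => ?_⟩
    refine eq_map_markBy_of_ae_markedPalm hQ.1 (hg 0) ?_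
    have hfst : ∀ᵐ z ∂(markedPalm Q), (∃ _ : ∃ m, (0, m) ∈ z.1.atoms,
        ∃! m : ℝ≥0, ∀ m', f z.1 m' ≤ f z.1 m) ∧
        ∀ m, f z.1 m ≤ f z.1 (leastArgmaxFrom f 0 z.1) := by
      have := hQ.1.1
      have h1 := hex.and hmax
      rw [← markedPalm_map_fst hQ.1.2.2] at h1
      exact ae_of_ae_map (by fun_prop) h1
    filter_upwards [hfst, ae_maximal_of_isIntensityOptimal hstat hmeas hadm hopt_bot.ne'
      hopt_top.ne (hg 0) hmax hQ] with z ⟨⟨_, hu⟩, hz⟩ hz'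
    exact hu.unique hz' hz
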